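/- Let $F$ be an arbitrary field. A symplectic alternating algebra (SAA) over $F$ is an $F$-vector space $L$ with a non-degenerate alternating bilinear form $(\cdot,\cdot)$ and a bilinear product satisfying $x\cdot x=0$ and $(x\cdot y,z)=(y\cdot z,x)$ for all $x,y,z\in L$. For subspaces $V,W$ let $VW$ be the span of all $v\cdot w$ with $v\in V$, $w\in W$; put $L^1=L$, $L^{k+1}=L^kL$. $L$ is nilpotent if $L^{c+1}=0$ for some $c$, and the least such $c$ is its class. Let $Z(L)=\{x: x\cdot y=0 \text{ for all } y\in L\}$; a subspace is isotropic if the form vanishes on it. Let $I_1=L^5L^2$, $I_2=L^7$, $I_3=L^6$, let $k$ be smallest with $I_k\cap L^4L^3\neq 0$, and let $U=\{x\in L^4 : x\cdot y\in I_k \text{ for all } y\in L^3\}$. For $r\in F$, $r\ne 0$, say that $L$ has presentation $\mathcal P_{10}^{(2,6)}(r)$ if it has a basis $x_1,y_1,\dots,x_5,y_5$ with $(x_i,x_j)=(y_i,y_j)=0$, $(x_i,y_j)=\delta_{ij}$, with $x_i\cdot x_j=0$ for all $i,j$ and $x_i\cdot y_j=0$ for $j\le i$, with $$(x_2y_3,y_5)=r,\quad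 (x_3y_4,y_5)=1,\quad (x_1y_2,y_5)=1,\quad (x_1y_3,y_4)=1,\quad (y_1y_2,y_3)=1,$$ and with all other values $(x_iy_j,y_k)$, $(y_iy_j,y_k)$ for $i<j<k$ equal to $0$. **Proposition 3.6.** (1) Let $L$ be a nilpotent SAA of dimension $10$ with isotropic centre of dimension $2$ and of class $7$, such that $L^4L^3\ne L^7$, $L^5L^2\le L^4L^3$ and $\dim UL^2=2$. Then $L$ has a presentation $\mathcal P_{10}^{(2,6)}(r)$ for some $r\neq0$. (2) For $r,s\neq 0$, the presentations $\mathcal P_{10}^{(2,6)}(r)$ and $\mathcal P_{10}^{(2,6)}(s)$ describe the same algebra if and only if $s/r\in (F^*)^{12}$; that is, an SAA with the first presentation and an SAA with the second are isomorphic (by a linear bijection preserving product and form) if and only if $s/r=a^{12}$ for some $a\in F^*$. (3) Conversely, every SAA with a presentation $\mathcal P_{10}^{(2,6)}(r)$, $r\ne0$, has all the properties listed in (1); and for every $r\neq0$ an SAA with this presentation exists. -/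

import Mathlib

universe u v w

/-- A symplectic alternating algebra structure on the `F`-vector space `L`: a non-degenerate
alternating form `(x, y)` and an alternating bilinear product `x · y` with
`(x · y, z) = (y · z, x)`. -/
structure SAA (F : Type u) (L : Type v) [Field F] [AddCommGroup L] [Module F L] where
  form : L →ₗ[F] L →ₗ[F] F
  mul : L →ₗ[F] L →ₗ[F] L
  form_self : ∀ x, form x x = 0
  form_nondegenerate : form.Nondegenerate
  mul_self : ∀ x, mul x x = 0
  form_mul : ∀ x y z, form (mul x y) z = form (mul y z) x

namespace SAA

section Basic

variable {F : Type u} {L : Type v} [Field F] [AddCommGroup L] [Module F L]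

/-- The product `U V` of subspaces: the span of all `u · v` with `u ∈ U`, `v ∈ V`. -/
def prod (A : SAA F L) (U V : Submodule F L) : Submodule F L :=
  Submodule.map₂ A.mul U V

/-- The lower central series `L ^ 1 = L`, `L ^ (k + 1) = L ^ k L`
(the value at `k = 0` is not used). -/
def lcs (A : SAA F L) : ℕ → Submodule F L
  | 0 => ⊤
  | 1 => ⊤
  | k + 2 => A.prod (lcs A (k + 1)) ⊤

def IsNilpotent (A : SAA F L) : Prop :=
  ∃ c : ℕ, A.lcs (c + 1) = ⊥

/-- The nilpotency class is the least `c` with `L ^ (c + 1) = 0`. -/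
def HasClass (A : SAA F L) (c : ℕ) : Prop :=
  IsLeast {m : ℕ | A.lcs (m + 1) = ⊥} c

/-- The centre `Z(L)`: all `x` with `x · y = 0` for every `y`. -/
def center (A : SAA F L) : Submodule F L :=
  LinearMap.ker A.mul

/-- A subspace on which the symplectic form vanishes. -/
def IsIsotropic (A : SAA F L) (U : Submodule F L) : Prop :=
  ∀ x ∈ U, ∀ y ∈ U, A.form x y = 0

/-- The ideals `I₁ = L⁵L²`, `I₂ = L⁷`, `I₃ = L⁶` (only the indices `1, 2, 3` are used). -/
def idealI (A : SAA F L) : ℕ → Submodule F L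
  | 1 => A.prod (A.lcs 5) (A.lcs 2)
  | 2 => A.lcs 7
  | _ => A.lcs 6

/-- The smallest `k ∈ {1, 2, 3}` with `I_k ∩ L⁴L³ ≠ 0`. -/
noncomputable def indexI (A : SAA F L) : ℕ :=
  sInf {k : ℕ | 1 ≤ k ∧ k ≤ 3 ∧ A.idealI k ⊓ A.prod (A.lcs 4) (A.lcs 3) ≠ ⊥}

/-- The subspace `U = {x ∈ L⁴ : x L³ ≤ I_k}`, with `k` the smallest index such that
`I_k ∩ L⁴L³ ≠ 0`. -/
noncomputable def subspaceU (A : SAA F L) : Submodule F L where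
  carrier := {x | x ∈ A.lcs 4 ∧ ∀ y ∈ A.lcs 3, A.mul x y ∈ A.idealI A.indexI}
  zero_mem' := ⟨zero_mem _, fun y _ => by simp⟩
  add_mem' := fun {a b} ha hb => ⟨add_mem ha.1 hb.1, fun y hy => by
    simpa using add_mem (ha.2 y hy) (hb.2 y hy)⟩
  smul_mem' := fun c x hx => ⟨Submodule.smul_mem _ c hx.1, fun y hy => by
    simpa using Submodule.smul_mem _ c (hx.2 y hy)⟩

/-- Nilpotent of dimension `10` and class `7`, with isotropic centre of dimension `2`, and such
that `L⁴L³ ≠ L⁷`, `L⁵L² ≤ L⁴L³` and `dim UL² = 2`. -/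
structure HasProperties (A : SAA F L) : Prop where
  dim_eq : Module.finrank F L = 10
  nilpotent : A.IsNilpotent
  center_isotropic : A.IsIsotropic A.center
  dim_center : Module.finrank F A.center = 2
  class_eq : A.HasClass 7
  ne : A.prod (A.lcs 4) (A.lcs 3) ≠ A.lcs 7
  le : A.prod (A.lcs 5) (A.lcs 2) ≤ A.prod (A.lcs 4) (A.lcs 3)
  dim_UL2 : Module.finrank F (A.prod A.subspaceU (A.lcs 2)) = 2

/-- A standard basis `x₁, …, xₙ, y₁, …, yₙ`, where `x_{i+1} = b (Sum.inl i)` and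
`y_{i+1} = b (Sum.inr i)`. -/
structure IsStandardBasis (A : SAA F L) {n : ℕ} (b : Module.Basis (Fin n ⊕ Fin n) F L) :
    Prop where
  form_x_x : ∀ i j, A.form (b (Sum.inl i)) (b (Sum.inl j)) = 0
  form_y_y : ∀ i j, A.form (b (Sum.inr i)) (b (Sum.inr j)) = 0
  form_x_y : ∀ i j, A.form (b (Sum.inl i)) (b (Sum.inr j)) = if i = j then 1 else 0

/-- `A` has, with respect to the standard basis `b`, the nilpotent presentation
`(x_i y_j, y_k) = α i j k`, `(y_i y_j, y_k) = β i j k` for `i < j < k`, where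
`x_i x_j = 0` for all `i, j` and `x_i y_j = 0` for `j ≤ i`. Up to the symmetries of the triple
product, the values not mentioned are thereby zero. -/
structure HasNilpotentPresentation (A : SAA F L) {n : ℕ}
    (b : Module.Basis (Fin n ⊕ Fin n) F L) (α β : Fin n → Fin n → Fin n → F) : Prop where
  standard : A.IsStandardBasis b
  x_mul_x : ∀ i j, A.mul (b (Sum.inl i)) (b (Sum.inl j)) = 0
  x_mul_y : ∀ i j, j ≤ i → A.mul (b (Sum.inl i)) (b (Sum.inr j)) = 0
  xyy : ∀ i j k, i < j → j < k →
    A.form (A.mul (b (Sum.inl i)) (b (Sum.inr j))) (b (Sum.inr k)) = α i j k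
  yyy : ∀ i j k, i < j → j < k →
    A.form (A.mul (b (Sum.inr i)) (b (Sum.inr j))) (b (Sum.inr k)) = β i j k

end Basic

/-- The values `(x₂y₃, y₅) = r`, `(x₃y₄, y₅) = 1`, `(x₁y₂, y₅) = 1`, `(x₁y₃, y₄) = 1`, and `0`
otherwise (indices are shifted by one, as `Fin 5` starts at `0`). -/
def presentationα {F : Type u} [Field F] (r : F) (i j k : Fin 5) : F :=
  if (i, j, k) = (1, 2, 4) then r
  else if (i, j, k) = (2, 3, 4) then 1
  else if (i, j, k) = (0, 1, 4) then 1
  else if (i, j, k) = (0, 2, 3) then 1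
  else 0

/-- The value `(y₁y₂, y₃) = 1`, and `0` otherwise. -/
def presentationβ {F : Type u} [Field F] (i j k : Fin 5) : F :=
  if (i, j, k) = (0, 1, 2) then 1 else 0

/-- `A` can be given by the presentation `P₁₀^(2,6)(r)`, i.e. satisfies it with respect to some
standard basis. -/
def HasPresentation {F : Type u} {L : Type v} [Field F] [AddCommGroup L] [Module F L]
    (A : SAA F L) (r : F) : Prop :=
  ∃ b : Module.Basis (Fin 5 ⊕ Fin 5) F L,
    A.HasNilpotentPresentation b (presentationα r) presentationβ

/-- Two symplectic alternating algebras are the same (isomorphic) if some linear bijection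
preserves both the form and the product. -/
def Isomorphic {F : Type u} {L : Type v} {L' : Type w} [Field F] [AddCommGroup L] [Module F L]
    [AddCommGroup L'] [Module F L'] (A : SAA F L) (A' : SAA F L') : Prop :=
  ∃ φ : L ≃ₗ[F] L',
    (∀ x y, A'.form (φ x) (φ y) = A.form x y) ∧ ∀ x y, φ (A.mul x y) = A'.mul (φ x) (φ y)

end SAA

/-! Write α_ijk = (x_i y_j, y_k) and β_ijk = (y_i y_j, y_k), with indices from 1 as in the lemma
names; the code counts from 0.

Since (uv, w) is an alternating trilinear form, (UV, W) = 0 is a symmetric condition on three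
subspaces. With L⁸ = 0 it gives L^i ⊥ L^j for i + j = 9 and L^i L^j = 0 for i + j = 8. The lower
central series then has dimensions 10, 8, 7, 6, 4, 3, 2 (`finrank_lcs`), so L^(9-k) is the
orthogonal complement of L^k for 2 ≤ k ≤ 7.

Existence: x₁, …, x₅ are chosen along L⁴ > L⁵ > L⁶ > L⁷ > L⁵L² and completed to a standard basis
(`HasProperties.exists_adaptedFrame`). This forces α123 = α124 = α234 = 0, while α125, α134, α235,
α345, β123 are nonzero; L⁴L³ ≠ L⁷ yields β123 and dim UL² = 2 yields α134. Twelve changes of basis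
kill the remaining values (`AdaptedFrame.exists_reduced`), and scaling turns all but α235 into 1.

Classification: the scalings y_i ↦ d_i y_i that keep the four ones have d = (a, a⁻⁴, a³, a⁻², a⁵),
and they multiply r by a¹². Two presented frames of one algebra are related by a change of basis
compatible with the lower central series; its diagonal entries obey the same equations, so nothing
else can happen to r (`PresentedFrame.div_eq_pow`).

Converse: in a presented algebra the lower central series is spanned by basis vectors, sorted by a
weight, and every property is read off the product table. Existence of the algebra is an explicit
model on F¹⁰. -/

namespace SAA

/-! ### Orthogonality and the lower central series -/

section General

variable {F : Type u} {L : Type v} [Field F] [AddCommGroup L] [Module F L] (A : SAA F L)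

theorem form_neg (u v : L) : A.form u v = -A.form v u := by
  have h := A.form_self (u + v)
  simp only [map_add, LinearMap.add_apply, A.form_self] at h
  linear_combination h

theorem form_isRefl : A.form.IsRefl := fun u v h => by rw [form_neg, h, neg_zero]

theorem mul_neg_comm (u v : L) : A.mul u v = -A.mul v u := by
  have h := A.mul_self (u + v)
  simp only [map_add, LinearMap.add_apply, A.mul_self, zero_add, add_zero] at h
  exact eq_neg_of_add_eq_zero_right h

theorem eq_zero_of_form {u : L} (h : ∀ v, A.form u v = 0) : u = 0 :=
  A.form_nondegenerate.1 u h

/-- The alternating trilinear form `(u · v, w)`. -/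
def triple (u v w : L) : F := A.form (A.mul u v) w

theorem triple_swap_left (u v w : L) : A.triple u v w = -A.triple v u w := by
  simp [triple, A.mul_neg_comm u v]

theorem triple_rotate (u v w : L) : A.triple u v w = A.triple v w u := A.form_mul u v w

theorem triple_swap_right (u v w : L) : A.triple u v w = -A.triple u w v := by
  rw [triple_rotate, triple_swap_left, triple_rotate, triple_rotate]

theorem triple_self_left (u w : L) : A.triple u u w = 0 := by simp [triple, A.mul_self]

theorem triple_self_right (u w : L) : A.triple u w w = 0 := by
  rw [triple_rotate, triple_self_left]

theorem triple_add_left (u u' v w : L) :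
    A.triple (u + u') v w = A.triple u v w + A.triple u' v w := by simp [triple]

theorem triple_add_mid (u v v' w : L) :
    A.triple u (v + v') w = A.triple u v w + A.triple u v' w := by simp [triple]

theorem triple_add_right (u v w w' : L) :
    A.triple u v (w + w') = A.triple u v w + A.triple u v w' := by simp [triple]

theorem triple_smul_left (c : F) (u v w : L) : A.triple (c • u) v w = c * A.triple u v w := by
  simp [triple]

theorem triple_smul_mid (c : F) (u v w : L) : A.triple u (c • v) w = c * A.triple u v w := by
  simp [triple]

theorem triple_smul_right (c : F) (u v w : L) : A.triple u v (c • w) = c * A.triple u v w := by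
  simp [triple]

theorem triple_sub_left (u u' v w : L) :
    A.triple (u - u') v w = A.triple u v w - A.triple u' v w := by simp [triple]

/-- The orthogonal complement of a subspace. -/
def perp (W : Submodule F L) : Submodule F L := LinearMap.BilinForm.orthogonal A.form W

theorem mem_perp {W : Submodule F L} {x : L} : x ∈ A.perp W ↔ ∀ w ∈ W, A.form x w = 0 := by
  rw [perp, LinearMap.BilinForm.mem_orthogonal_iff]
  exact forall₂_congr fun w _ => A.form_isRefl.eq_iff

theorem mem_prod {U V : Submodule F L} {u v : L} (hu : u ∈ U) (hv : v ∈ V) :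
    A.mul u v ∈ A.prod U V := Submodule.apply_mem_map₂ _ hu hv

theorem prod_le {U V W : Submodule F L} : A.prod U V ≤ W ↔ ∀ u ∈ U, ∀ v ∈ V, A.mul u v ∈ W :=
  Submodule.map₂_le

theorem prod_mono {U V U' V' : Submodule F L} (h : U ≤ U') (h' : V ≤ V') :
    A.prod U V ≤ A.prod U' V' := Submodule.map₂_le_map₂ h h'

theorem le_perp_comm {U V : Submodule F L} : U ≤ A.perp V ↔ V ≤ A.perp U := by
  constructor <;>
  · intro h x hx
    rw [mem_perp]
    intro w hw
    rw [form_neg, (A.mem_perp.1 (h hw)) x hx, neg_zero]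

/-- `(UV, W) = 0` if and only if `(VW, U) = 0`. -/
theorem prod_le_perp {U V W : Submodule F L} :
    A.prod U V ≤ A.perp W ↔ A.prod V W ≤ A.perp U := by
  simp only [prod_le, mem_perp]
  constructor
  · intro h v hv w hw u hu
    rw [← A.form_mul]; exact h u hu v hv w hw
  · intro h u hu v hv w hw
    rw [A.form_mul]; exact h v hv w hw u hu

theorem prod_comm (U V : Submodule F L) : A.prod U V = A.prod V U := by
  apply le_antisymm <;>
  · rw [prod_le]
    intro u hu v hv
    rw [mul_neg_comm]
    exact neg_mem (A.mem_prod hv hu)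

theorem lcs_one : A.lcs 1 = ⊤ := rfl

theorem lcs_succ_succ (k : ℕ) : A.lcs (k + 2) = A.prod (A.lcs (k + 1)) ⊤ := rfl

theorem mul_mem_lcs {k : ℕ} {u : L} (hu : u ∈ A.lcs (k + 1)) (v : L) :
    A.mul u v ∈ A.lcs (k + 2) := A.mem_prod hu trivial

theorem lcs_succ_le : ∀ k, A.lcs (k + 1) ≤ A.lcs k
  | 0 => le_top
  | 1 => le_top
  | k + 2 => by
    rw [lcs_succ_succ, lcs_succ_succ]
    exact A.prod_mono (lcs_succ_le (k + 1)) le_rfl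

theorem lcs_antitone : Antitone A.lcs := antitone_nat_of_succ_le A.lcs_succ_le

theorem perp_top : A.perp ⊤ = ⊥ :=
  eq_bot_iff.2 fun _ hx => (Submodule.mem_bot F).2
    (A.eq_zero_of_form fun v => A.mem_perp.1 hx v trivial)

/-- (UL, L^(k+1)) = 0 says the same as (L^(k+1)L, U) = 0. This is the step by which `lcs_le_perp`
trades a factor L from one side to the other. -/
theorem prod_top_le_perp {k : ℕ} {U : Submodule F L} :
    A.prod U ⊤ ≤ A.perp (A.lcs (k + 1)) ↔ U ≤ A.perp (A.lcs (k + 2)) := by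
  rw [prod_le_perp, le_perp_comm, lcs_succ_succ, A.prod_comm ⊤, le_perp_comm, le_perp_comm]

/-- If `L^(i+j+1) = 0`, then `L^(i+1)` is orthogonal to `L^(j+1)`. -/
theorem lcs_le_perp : ∀ {j i : ℕ}, A.lcs (i + j + 1) = ⊥ → A.lcs (i + 1) ≤ A.perp (A.lcs (j + 1))
  | 0, i, h => by rw [show i + 0 + 1 = i + 1 from rfl] at h; rw [h]; exact bot_le
  | j + 1, i, h => by
    rw [← prod_top_le_perp, ← lcs_succ_succ]
    exact lcs_le_perp (j := j) (i := i + 1) (by rw [← h]; congr 1; omega)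

/-- By non-degeneracy a product vanishes once it is orthogonal to L, and (U L^(j+1), L) = 0 means
(L^(j+1)L, U) = 0. -/
theorem prod_le_perp_lcs {U : Submodule F L} {j : ℕ} (h : U ≤ A.perp (A.lcs (j + 2))) :
    A.prod U (A.lcs (j + 1)) = ⊥ := by
  rw [eq_bot_iff, ← A.perp_top, prod_le_perp, ← lcs_succ_succ, le_perp_comm]
  exact h

/-- If `L^(i+j+2) = 0`, then `L^(i+1) L^(j+1) = 0`. -/
theorem mul_eq_zero_of_lcs {i j : ℕ} (h : A.lcs (i + j + 2) = ⊥) {u v : L}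
    (hu : u ∈ A.lcs (i + 1)) (hv : v ∈ A.lcs (j + 1)) : A.mul u v = 0 := by
  have := A.prod_le_perp_lcs (A.lcs_le_perp (j := j + 1) (i := i) (by rw [← h]; congr 1))
  rw [← Submodule.mem_bot F, ← this]
  exact A.mem_prod hu hv

theorem center_eq_perp : A.center = A.perp (A.lcs 2) := by
  ext x
  rw [center, LinearMap.mem_ker, ← Submodule.span_singleton_le_iff_mem x (A.perp _),
    ← prod_top_le_perp (k := 0), lcs_one, perp_top, le_bot_iff]
  constructor
  · intro h
    rw [eq_bot_iff, prod_le]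
    intro u hu v _
    obtain ⟨c, rfl⟩ := Submodule.mem_span_singleton.1 hu
    simp [h]
  · intro h
    ext v
    have := A.mem_prod (Submodule.mem_span_singleton_self x) (Submodule.mem_top (x := v))
    rw [h] at this
    simpa using this

theorem mem_center {x : L} : x ∈ A.center ↔ ∀ y, A.mul x y = 0 := by
  rw [center, LinearMap.mem_ker, LinearMap.ext_iff]; rfl

theorem finrank_perp [FiniteDimensional F L] (W : Submodule F L) :
    Module.finrank F (A.perp W) = Module.finrank F L - Module.finrank F W :=
  LinearMap.BilinForm.finrank_orthogonal A.form_nondegenerate W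

end General


/-! ### Frames and their changes of basis -/

section Frame

variable {F : Type u} {L : Type v} [Field F] [AddCommGroup L] [Module F L]

/-- Vectors `x₁, …, x₅, y₁, …, y₅` with the relations of a standard basis, such that `x_i x_j = 0`
for all `i, j` and `x_i y_j = 0` for `j ≤ i`. -/
structure Frame (A : SAA F L) (x y : Fin 5 → L) : Prop where
  form_xx : ∀ i j, A.form (x i) (x j) = 0
  form_yy : ∀ i j, A.form (y i) (y j) = 0
  form_xy : ∀ i j, A.form (x i) (y j) = if i = j then 1 else 0
  mul_xx : ∀ i j, A.mul (x i) (x j) = 0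
  mul_xy : ∀ i j, j ≤ i → A.mul (x i) (y j) = 0

namespace Frame

variable {A : SAA F L} {x y : Fin 5 → L} (h : A.Frame x y)
include h

theorem form_yx (i j : Fin 5) : A.form (y i) (x j) = if i = j then -1 else 0 := by
  rw [form_neg, h.form_xy]
  split_ifs <;> simp_all

theorem triple_xx (i j : Fin 5) (w : L) : A.triple (x i) (x j) w = 0 := by
  simp [triple, h.mul_xx]

theorem triple_xy (i j : Fin 5) (w : L) (hij : j ≤ i) : A.triple (x i) (y j) w = 0 := by
  simp [triple, h.mul_xy i j hij]

theorem triple_xx' (i j : Fin 5) (w : L) : A.triple (x i) w (x j) = 0 := by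
  rw [triple_swap_right, h.triple_xx, neg_zero]

theorem triple_xy' (i j : Fin 5) (w : L) (hij : j ≤ i) : A.triple (x i) w (y j) = 0 := by
  rw [triple_swap_right, h.triple_xy i j w hij, neg_zero]

end Frame

/-- Rules that bring `triple` of frame vectors into the order `x` before `y`, indices
increasing. -/
theorem Frame.rules {A : SAA F L} {x y : Fin 5 → L} (h : A.Frame x y) :
    (∀ i j w, A.triple (x i) (x j) w = 0) ∧
    (∀ i j w, A.triple (x i) w (x j) = 0) ∧
    (∀ i j w, A.triple w (x i) (x j) = 0) ∧
    (∀ i j w, j ≤ i → A.triple (x i) (y j) w = 0) ∧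
    (∀ i j w, j ≤ i → A.triple (x i) w (y j) = 0) ∧
    (∀ i j w, A.triple (y i) (x j) w = - A.triple (x j) (y i) w) ∧
    (∀ i j w, A.triple w (y i) (x j) = - A.triple w (x j) (y i)) ∧
    (∀ i w, A.triple (y i) (y i) w = 0) ∧
    (∀ i w, A.triple w (y i) (y i) = 0) ∧
    (∀ i j w, j < i → A.triple (y i) (y j) w = - A.triple (y j) (y i) w) ∧
    (∀ i j w, j < i → A.triple w (y i) (y j) = - A.triple w (y j) (y i)) :=
  ⟨h.triple_xx, h.triple_xx', fun i j w => by rw [triple_rotate, h.triple_xx], h.triple_xy,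
    h.triple_xy', fun _ _ _ => A.triple_swap_left _ _ _, fun _ _ _ => A.triple_swap_right _ _ _,
    fun _ _ => A.triple_self_left _ _, fun _ _ => A.triple_self_right _ _,
    fun _ _ _ _ => A.triple_swap_left _ _ _, fun _ _ _ _ => A.triple_swap_right _ _ _⟩

open Function in
/-- The change of basis `y_j ↦ y_j + c y_i`, `x_i ↦ x_i - c x_j` for `i < j`. -/
theorem Frame.shear {A : SAA F L} {x y : Fin 5 → L} (h : A.Frame x y) {i j : Fin 5} (hij : i < j)
    (c : F) : A.Frame (update x i (x i - c • x j)) (update y j (y j + c • y i)) := by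
  have hne := hij.ne
  refine ⟨fun a b => ?_, fun a b => ?_, fun a b => ?_, fun a b => ?_, fun a b hab => ?_⟩
  · simp only [update_apply]
    split_ifs <;> simp [h.form_xx]
  · simp only [update_apply]
    split_ifs <;> simp [h.form_yy]
  · simp only [update_apply]
    split_ifs <;> simp [h.form_xy] <;> grind
  · simp only [update_apply]
    split_ifs <;> simp [h.mul_xx]
  · simp only [update_apply]
    have h1 := h.mul_xy
    split_ifs with h2 h3 h3
    · omega
    · subst h2
      simp [h.mul_xy _ _ hab, h.mul_xy _ _ (hab.trans hij.le)]
    · subst h3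
      simp [h.mul_xy _ _ hab, h.mul_xy _ _ (hij.le.trans hab)]
    · exact h.mul_xy _ _ hab

open Function in
/-- The change of basis `y_i ↦ y_i + c x_j`, `y_j ↦ y_j + c x_i` for `i ≠ j`. -/
theorem Frame.mix {A : SAA F L} {x y : Fin 5 → L} (h : A.Frame x y) {i j : Fin 5} (hij : i ≠ j)
    (c : F) : A.Frame x (update (update y i (y i + c • x j)) j (y j + c • x i)) := by
  refine ⟨h.form_xx, fun a b => ?_, fun a b => ?_, h.mul_xx, fun a b hab => ?_⟩
  · simp only [update_apply]
    split_ifs <;> simp [h.form_yy, h.form_xy, h.form_yx, h.form_xx] <;> grind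
  · simp only [update_apply]
    split_ifs <;> simp [h.form_xy, h.form_xx] <;> grind
  · simp only [update_apply]
    split_ifs <;> simp_all [h.mul_xx, h.mul_xy]

theorem Frame.scale {A : SAA F L} {x y : Fin 5 → L} (h : A.Frame x y) {d : Fin 5 → F}
    (hd : ∀ i, d i ≠ 0) : A.Frame (fun i => (d i)⁻¹ • x i) (fun i => d i • y i) := by
  refine ⟨fun a b => ?_, fun a b => ?_, fun a b => ?_, fun a b => ?_, fun a b hab => ?_⟩
  · simp [h.form_xx]
  · simp [h.form_yy]
  · simp only [map_smul, LinearMap.smul_apply, h.form_xy, smul_eq_mul]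
    split_ifs with hab
    · subst hab; field_simp [hd a]
    · simp
  · simp [h.mul_xx]
  · simp [h.mul_xy _ _ hab]

/-- The values of the trilinear form that are forced by the characteristic subspaces. -/
structure AdaptedFrame (A : SAA F L) (x y : Fin 5 → L) : Prop extends A.Frame x y where
  α123 : A.triple (x 0) (y 1) (y 2) = 0
  α124 : A.triple (x 0) (y 1) (y 3) = 0
  α234 : A.triple (x 1) (y 2) (y 3) = 0
  α125 : A.triple (x 0) (y 1) (y 4) ≠ 0
  α134 : A.triple (x 0) (y 2) (y 3) ≠ 0
  α235 : A.triple (x 1) (y 2) (y 4) ≠ 0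
  α345 : A.triple (x 2) (y 3) (y 4) ≠ 0
  β123 : A.triple (y 0) (y 1) (y 2) ≠ 0

theorem AdaptedFrame.values {A : SAA F L} {x y : Fin 5 → L} (h : A.AdaptedFrame x y) :
    A.triple (x 0) (y 1) (y 2) = 0 ∧
    A.triple (x 0) (y 1) (y 3) = 0 ∧
    A.triple (x 1) (y 2) (y 3) = 0 ∧
    A.triple (x 0) (y 1) (y 4) ≠ 0 ∧
    A.triple (x 0) (y 2) (y 3) ≠ 0 ∧
    A.triple (x 1) (y 2) (y 4) ≠ 0 ∧
    A.triple (x 2) (y 3) (y 4) ≠ 0 ∧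
    A.triple (y 0) (y 1) (y 2) ≠ 0 :=
  ⟨h.α123, h.α124, h.α234, h.α125, h.α134, h.α235, h.α345, h.β123⟩

/-! ### Removing the superfluous values of the trilinear form -/

section Reduction

attribute [local simp] triple_add_left triple_add_mid triple_add_right triple_smul_left
  triple_smul_mid triple_smul_right triple_sub_left

variable {A : SAA F L} {x y : Fin 5 → L} (h : A.AdaptedFrame x y)
include h

/-- Model for the twelve steps: a shear or mix adds to the target value a multiple of one of the
five nonzero values (here β123), and the constant is chosen to cancel it. The order of the steps
ensures that no value already killed reappears, and the defining conditions of an adapted frame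
survive. -/
theorem AdaptedFrame.exists_β124 :
    ∃ x y : Fin 5 → L, A.AdaptedFrame x y ∧
      A.triple (y 0) (y 1) (y 3) = 0 := by
  have hr := h.rules
  have hv := h.values
  refine ⟨_, _, ⟨h.shear (i := 2) (j := 3) (by decide)
    (-A.triple (y 0) (y 1) (y 3) / A.triple (y 0) (y 1) (y 2)),
    ?_, ?_, ?_, ?_, ?_, ?_, ?_, ?_⟩, ?_⟩
  all_goals simp [hr, hv]

theorem AdaptedFrame.exists_α245
    (hk : A.triple (y 0) (y 1) (y 3) = 0) :
    ∃ x y : Fin 5 → L, A.AdaptedFrame x y ∧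
      A.triple (y 0) (y 1) (y 3) = 0 ∧
      A.triple (x 1) (y 3) (y 4) = 0 := by
  have hr := h.rules
  have hv := h.values
  refine ⟨_, _, ⟨h.shear (i := 1) (j := 2) (by decide)
    (A.triple (x 1) (y 3) (y 4) / A.triple (x 2) (y 3) (y 4)),
    ?_, ?_, ?_, ?_, ?_, ?_, ?_, ?_⟩, ?_, ?_⟩
  all_goals simp [hr, hv, hk]

theorem AdaptedFrame.exists_α135
    (hk : A.triple (y 0) (y 1) (y 3) = 0 ∧
      A.triple (x 1) (y 3) (y 4) = 0) :
    ∃ x y : Fin 5 → L, A.AdaptedFrame x y ∧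
      A.triple (y 0) (y 1) (y 3) = 0 ∧
      A.triple (x 1) (y 3) (y 4) = 0 ∧
      A.triple (x 0) (y 2) (y 4) = 0 := by
  have hr := h.rules
  have hv := h.values
  refine ⟨_, _, ⟨h.shear (i := 3) (j := 4) (by decide)
    (-A.triple (x 0) (y 2) (y 4) / A.triple (x 0) (y 2) (y 3)),
    ?_, ?_, ?_, ?_, ?_, ?_, ?_, ?_⟩, ?_, ?_, ?_⟩
  all_goals simp [hr, hv, hk]

theorem AdaptedFrame.exists_β125
    (hk : A.triple (y 0) (y 1) (y 3) = 0 ∧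
      A.triple (x 1) (y 3) (y 4) = 0 ∧
      A.triple (x 0) (y 2) (y 4) = 0) :
    ∃ x y : Fin 5 → L, A.AdaptedFrame x y ∧
      A.triple (y 0) (y 1) (y 3) = 0 ∧
      A.triple (x 1) (y 3) (y 4) = 0 ∧
      A.triple (x 0) (y 2) (y 4) = 0 ∧
      A.triple (y 0) (y 1) (y 4) = 0 := by
  have hr := h.rules
  have hv := h.values
  refine ⟨_, _, ⟨h.shear (i := 2) (j := 4) (by decide)
    (-A.triple (y 0) (y 1) (y 4) / A.triple (y 0) (y 1) (y 2)),
    ?_, ?_, ?_, ?_, ?_, ?_, ?_, ?_⟩, ?_, ?_, ?_, ?_⟩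
  all_goals simp [hr, hv, hk]

theorem AdaptedFrame.exists_β134
    (hk : A.triple (y 0) (y 1) (y 3) = 0 ∧
      A.triple (x 1) (y 3) (y 4) = 0 ∧
      A.triple (x 0) (y 2) (y 4) = 0 ∧
      A.triple (y 0) (y 1) (y 4) = 0) :
    ∃ x y : Fin 5 → L, A.AdaptedFrame x y ∧
      A.triple (y 0) (y 1) (y 3) = 0 ∧
      A.triple (x 1) (y 3) (y 4) = 0 ∧
      A.triple (x 0) (y 2) (y 4) = 0 ∧
      A.triple (y 0) (y 1) (y 4) = 0 ∧
      A.triple (y 0) (y 2) (y 3) = 0 := by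
  have hr := h.rules
  have hv := h.values
  refine ⟨_, _, ⟨h.shear (i := 1) (j := 3) (by decide)
    (A.triple (y 0) (y 2) (y 3) / A.triple (y 0) (y 1) (y 2)),
    ?_, ?_, ?_, ?_, ?_, ?_, ?_, ?_⟩, ?_, ?_, ?_, ?_, ?_⟩
  all_goals simp [hr, hv, hk]

theorem AdaptedFrame.exists_α145
    (hk : A.triple (y 0) (y 1) (y 3) = 0 ∧
      A.triple (x 1) (y 3) (y 4) = 0 ∧
      A.triple (x 0) (y 2) (y 4) = 0 ∧
      A.triple (y 0) (y 1) (y 4) = 0 ∧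
      A.triple (y 0) (y 2) (y 3) = 0) :
    ∃ x y : Fin 5 → L, A.AdaptedFrame x y ∧
      A.triple (y 0) (y 1) (y 3) = 0 ∧
      A.triple (x 1) (y 3) (y 4) = 0 ∧
      A.triple (x 0) (y 2) (y 4) = 0 ∧
      A.triple (y 0) (y 1) (y 4) = 0 ∧
      A.triple (y 0) (y 2) (y 3) = 0 ∧
      A.triple (x 0) (y 3) (y 4) = 0 := by
  have hr := h.rules
  have hv := h.values
  refine ⟨_, _, ⟨h.shear (i := 0) (j := 2) (by decide)
    (A.triple (x 0) (y 3) (y 4) / A.triple (x 2) (y 3) (y 4)),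
    ?_, ?_, ?_, ?_, ?_, ?_, ?_, ?_⟩, ?_, ?_, ?_, ?_, ?_, ?_⟩
  all_goals simp [hr, hv, hk]

theorem AdaptedFrame.exists_β135
    (hk : A.triple (y 0) (y 1) (y 3) = 0 ∧
      A.triple (x 1) (y 3) (y 4) = 0 ∧
      A.triple (x 0) (y 2) (y 4) = 0 ∧
      A.triple (y 0) (y 1) (y 4) = 0 ∧
      A.triple (y 0) (y 2) (y 3) = 0 ∧
      A.triple (x 0) (y 3) (y 4) = 0) :
    ∃ x y : Fin 5 → L, A.AdaptedFrame x y ∧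
      A.triple (y 0) (y 1) (y 3) = 0 ∧
      A.triple (x 1) (y 3) (y 4) = 0 ∧
      A.triple (x 0) (y 2) (y 4) = 0 ∧
      A.triple (y 0) (y 1) (y 4) = 0 ∧
      A.triple (y 0) (y 2) (y 3) = 0 ∧
      A.triple (x 0) (y 3) (y 4) = 0 ∧
      A.triple (y 0) (y 2) (y 4) = 0 := by
  have hr := h.rules
  have hv := h.values
  refine ⟨_, _, ⟨h.shear (i := 1) (j := 4) (by decide)
    (A.triple (y 0) (y 2) (y 4) / A.triple (y 0) (y 1) (y 2)),
    ?_, ?_, ?_, ?_, ?_, ?_, ?_, ?_⟩, ?_, ?_, ?_, ?_, ?_, ?_, ?_⟩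
  all_goals simp [hr, hv, hk]

theorem AdaptedFrame.exists_β234
    (hk : A.triple (y 0) (y 1) (y 3) = 0 ∧
      A.triple (x 1) (y 3) (y 4) = 0 ∧
      A.triple (x 0) (y 2) (y 4) = 0 ∧
      A.triple (y 0) (y 1) (y 4) = 0 ∧
      A.triple (y 0) (y 2) (y 3) = 0 ∧
      A.triple (x 0) (y 3) (y 4) = 0 ∧
      A.triple (y 0) (y 2) (y 4) = 0) :
    ∃ x y : Fin 5 → L, A.AdaptedFrame x y ∧
      A.triple (y 0) (y 1) (y 3) = 0 ∧
      A.triple (x 1) (y 3) (y 4) = 0 ∧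
      A.triple (x 0) (y 2) (y 4) = 0 ∧
      A.triple (y 0) (y 1) (y 4) = 0 ∧
      A.triple (y 0) (y 2) (y 3) = 0 ∧
      A.triple (x 0) (y 3) (y 4) = 0 ∧
      A.triple (y 0) (y 2) (y 4) = 0 ∧
      A.triple (y 1) (y 2) (y 3) = 0 := by
  have hr := h.rules
  have hv := h.values
  refine ⟨_, _, ⟨h.shear (i := 0) (j := 3) (by decide)
    (-A.triple (y 1) (y 2) (y 3) / A.triple (y 0) (y 1) (y 2)),
    ?_, ?_, ?_, ?_, ?_, ?_, ?_, ?_⟩, ?_, ?_, ?_, ?_, ?_, ?_, ?_, ?_⟩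
  all_goals simp [hr, hv, hk]

theorem AdaptedFrame.exists_β145
    (hk : A.triple (y 0) (y 1) (y 3) = 0 ∧
      A.triple (x 1) (y 3) (y 4) = 0 ∧
      A.triple (x 0) (y 2) (y 4) = 0 ∧
      A.triple (y 0) (y 1) (y 4) = 0 ∧
      A.triple (y 0) (y 2) (y 3) = 0 ∧
      A.triple (x 0) (y 3) (y 4) = 0 ∧
      A.triple (y 0) (y 2) (y 4) = 0 ∧
      A.triple (y 1) (y 2) (y 3) = 0) :
    ∃ x y : Fin 5 → L, A.AdaptedFrame x y ∧
      A.triple (y 0) (y 1) (y 3) = 0 ∧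
      A.triple (x 1) (y 3) (y 4) = 0 ∧
      A.triple (x 0) (y 2) (y 4) = 0 ∧
      A.triple (y 0) (y 1) (y 4) = 0 ∧
      A.triple (y 0) (y 2) (y 3) = 0 ∧
      A.triple (x 0) (y 3) (y 4) = 0 ∧
      A.triple (y 0) (y 2) (y 4) = 0 ∧
      A.triple (y 1) (y 2) (y 3) = 0 ∧
      A.triple (y 0) (y 3) (y 4) = 0 := by
  have hr := h.rules
  have hv := h.values
  refine ⟨_, _, ⟨h.mix (i := 0) (j := 2) (by decide)
    (-A.triple (y 0) (y 3) (y 4) / A.triple (x 2) (y 3) (y 4)),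
    ?_, ?_, ?_, ?_, ?_, ?_, ?_, ?_⟩, ?_, ?_, ?_, ?_, ?_, ?_, ?_, ?_, ?_⟩
  all_goals simp [hr, hv, hk]

/-- This follows the removal of β145 because the mix used there puts a multiple of x₁ into y₃ and so
changes β235 by a multiple of α125 ≠ 0. -/
theorem AdaptedFrame.exists_β235
    (hk : A.triple (y 0) (y 1) (y 3) = 0 ∧
      A.triple (x 1) (y 3) (y 4) = 0 ∧
      A.triple (x 0) (y 2) (y 4) = 0 ∧
      A.triple (y 0) (y 1) (y 4) = 0 ∧
      A.triple (y 0) (y 2) (y 3) = 0 ∧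
      A.triple (x 0) (y 3) (y 4) = 0 ∧
      A.triple (y 0) (y 2) (y 4) = 0 ∧
      A.triple (y 1) (y 2) (y 3) = 0 ∧
      A.triple (y 0) (y 3) (y 4) = 0) :
    ∃ x y : Fin 5 → L, A.AdaptedFrame x y ∧
      A.triple (y 0) (y 1) (y 3) = 0 ∧
      A.triple (x 1) (y 3) (y 4) = 0 ∧
      A.triple (x 0) (y 2) (y 4) = 0 ∧
      A.triple (y 0) (y 1) (y 4) = 0 ∧
      A.triple (y 0) (y 2) (y 3) = 0 ∧
      A.triple (x 0) (y 3) (y 4) = 0 ∧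
      A.triple (y 0) (y 2) (y 4) = 0 ∧
      A.triple (y 1) (y 2) (y 3) = 0 ∧
      A.triple (y 0) (y 3) (y 4) = 0 ∧
      A.triple (y 1) (y 2) (y 4) = 0 := by
  have hr := h.rules
  have hv := h.values
  refine ⟨_, _, ⟨h.shear (i := 0) (j := 4) (by decide)
    (-A.triple (y 1) (y 2) (y 4) / A.triple (y 0) (y 1) (y 2)),
    ?_, ?_, ?_, ?_, ?_, ?_, ?_, ?_⟩, ?_, ?_, ?_, ?_, ?_, ?_, ?_, ?_, ?_, ?_⟩
  all_goals simp [hr, hv, hk]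

theorem AdaptedFrame.exists_β245
    (hk : A.triple (y 0) (y 1) (y 3) = 0 ∧
      A.triple (x 1) (y 3) (y 4) = 0 ∧
      A.triple (x 0) (y 2) (y 4) = 0 ∧
      A.triple (y 0) (y 1) (y 4) = 0 ∧
      A.triple (y 0) (y 2) (y 3) = 0 ∧
      A.triple (x 0) (y 3) (y 4) = 0 ∧
      A.triple (y 0) (y 2) (y 4) = 0 ∧
      A.triple (y 1) (y 2) (y 3) = 0 ∧
      A.triple (y 0) (y 3) (y 4) = 0 ∧
      A.triple (y 1) (y 2) (y 4) = 0) :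
    ∃ x y : Fin 5 → L, A.AdaptedFrame x y ∧
      A.triple (y 0) (y 1) (y 3) = 0 ∧
      A.triple (x 1) (y 3) (y 4) = 0 ∧
      A.triple (x 0) (y 2) (y 4) = 0 ∧
      A.triple (y 0) (y 1) (y 4) = 0 ∧
      A.triple (y 0) (y 2) (y 3) = 0 ∧
      A.triple (x 0) (y 3) (y 4) = 0 ∧
      A.triple (y 0) (y 2) (y 4) = 0 ∧
      A.triple (y 1) (y 2) (y 3) = 0 ∧
      A.triple (y 0) (y 3) (y 4) = 0 ∧
      A.triple (y 1) (y 2) (y 4) = 0 ∧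
      A.triple (y 1) (y 3) (y 4) = 0 := by
  have hr := h.rules
  have hv := h.values
  refine ⟨_, _, ⟨h.mix (i := 0) (j := 3) (by decide)
    (A.triple (y 1) (y 3) (y 4) / A.triple (x 0) (y 1) (y 4)),
    ?_, ?_, ?_, ?_, ?_, ?_, ?_, ?_⟩, ?_, ?_, ?_, ?_, ?_, ?_, ?_, ?_, ?_, ?_, ?_⟩
  all_goals simp [hr, hv, hk]

theorem AdaptedFrame.exists_β345
    (hk : A.triple (y 0) (y 1) (y 3) = 0 ∧
      A.triple (x 1) (y 3) (y 4) = 0 ∧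
      A.triple (x 0) (y 2) (y 4) = 0 ∧
      A.triple (y 0) (y 1) (y 4) = 0 ∧
      A.triple (y 0) (y 2) (y 3) = 0 ∧
      A.triple (x 0) (y 3) (y 4) = 0 ∧
      A.triple (y 0) (y 2) (y 4) = 0 ∧
      A.triple (y 1) (y 2) (y 3) = 0 ∧
      A.triple (y 0) (y 3) (y 4) = 0 ∧
      A.triple (y 1) (y 2) (y 4) = 0 ∧
      A.triple (y 1) (y 3) (y 4) = 0) :
    ∃ x y : Fin 5 → L, A.AdaptedFrame x y ∧
      A.triple (y 0) (y 1) (y 3) = 0 ∧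
      A.triple (x 1) (y 3) (y 4) = 0 ∧
      A.triple (x 0) (y 2) (y 4) = 0 ∧
      A.triple (y 0) (y 1) (y 4) = 0 ∧
      A.triple (y 0) (y 2) (y 3) = 0 ∧
      A.triple (x 0) (y 3) (y 4) = 0 ∧
      A.triple (y 0) (y 2) (y 4) = 0 ∧
      A.triple (y 1) (y 2) (y 3) = 0 ∧
      A.triple (y 0) (y 3) (y 4) = 0 ∧
      A.triple (y 1) (y 2) (y 4) = 0 ∧
      A.triple (y 1) (y 3) (y 4) = 0 ∧
      A.triple (y 2) (y 3) (y 4) = 0 := by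
  have hr := h.rules
  have hv := h.values
  refine ⟨_, _, ⟨h.mix (i := 0) (j := 4) (by decide)
    (-A.triple (y 2) (y 3) (y 4) / A.triple (x 0) (y 2) (y 3)),
    ?_, ?_, ?_, ?_, ?_, ?_, ?_, ?_⟩, ?_, ?_, ?_, ?_, ?_, ?_, ?_, ?_, ?_, ?_, ?_, ?_⟩
  all_goals simp [hr, hv, hk]

/-- All values that do not occur in the presentation can be removed. -/
theorem AdaptedFrame.exists_reduced :
    ∃ x y : Fin 5 → L, A.AdaptedFrame x y ∧
      A.triple (y 0) (y 1) (y 3) = 0 ∧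
      A.triple (x 1) (y 3) (y 4) = 0 ∧
      A.triple (x 0) (y 2) (y 4) = 0 ∧
      A.triple (y 0) (y 1) (y 4) = 0 ∧
      A.triple (y 0) (y 2) (y 3) = 0 ∧
      A.triple (x 0) (y 3) (y 4) = 0 ∧
      A.triple (y 0) (y 2) (y 4) = 0 ∧
      A.triple (y 1) (y 2) (y 3) = 0 ∧
      A.triple (y 0) (y 3) (y 4) = 0 ∧
      A.triple (y 1) (y 2) (y 4) = 0 ∧
      A.triple (y 1) (y 3) (y 4) = 0 ∧
      A.triple (y 2) (y 3) (y 4) = 0 := by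
  obtain ⟨_, _, h, hk⟩ := h.exists_β124
  obtain ⟨_, _, h, hk⟩ := h.exists_α245 hk
  obtain ⟨_, _, h, hk⟩ := h.exists_α135 hk
  obtain ⟨_, _, h, hk⟩ := h.exists_β125 hk
  obtain ⟨_, _, h, hk⟩ := h.exists_β134 hk
  obtain ⟨_, _, h, hk⟩ := h.exists_α145 hk
  obtain ⟨_, _, h, hk⟩ := h.exists_β135 hk
  obtain ⟨_, _, h, hk⟩ := h.exists_β234 hk
  obtain ⟨_, _, h, hk⟩ := h.exists_β145 hk
  obtain ⟨_, _, h, hk⟩ := h.exists_β235 hk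
  obtain ⟨_, _, h, hk⟩ := h.exists_β245 hk
  obtain ⟨_, _, h, hk⟩ := h.exists_β345 hk
  exact ⟨_, _, h, hk⟩

end Reduction

end Frame


/-! ### From a reduced frame to a presentation -/

section FrameBasis

variable {F : Type u} {L : Type v} [Field F] [AddCommGroup L] [Module F L]

theorem linearIndependent_of_standard (A : SAA F L) {n : ℕ} {x y : Fin n → L}
    (hxx : ∀ i j, A.form (x i) (x j) = 0) (hyy : ∀ i j, A.form (y i) (y j) = 0)
    (hxy : ∀ i j, A.form (x i) (y j) = if i = j then 1 else 0) :
    LinearIndependent F (Sum.elim x y) := by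
  rw [Fintype.linearIndependent_iff]
  intro g hg
  simp only [Fintype.sum_sum_type, Sum.elim_inl, Sum.elim_inr] at hg
  rintro (i | i)
  · have := congrArg (fun v => A.form v (y i)) hg
    simpa [hxy, hyy] using this
  · have := congrArg (fun v => A.form (x i) v) hg
    simpa [hxy, hxx] using this

theorem exists_basis_of_standard (A : SAA F L) {n : ℕ} [NeZero n]
    (hn : Module.finrank F L = 2 * n) {x y : Fin n → L}
    (hxx : ∀ i j, A.form (x i) (x j) = 0) (hyy : ∀ i j, A.form (y i) (y j) = 0)
    (hxy : ∀ i j, A.form (x i) (y j) = if i = j then 1 else 0) :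
    ∃ b : Module.Basis (Fin n ⊕ Fin n) F L,
      (∀ i, b (Sum.inl i) = x i) ∧ ∀ i, b (Sum.inr i) = y i := by
  refine ⟨basisOfLinearIndependentOfCardEqFinrank
    (A.linearIndependent_of_standard hxx hyy hxy) (by simp [hn]; ring), ?_, ?_⟩ <;> simp

/-- A frame with the right values of the trilinear form yields a presentation. -/
theorem Frame.hasPresentation {A : SAA F L} {x y : Fin 5 → L} (h : A.Frame x y)
    (hn : Module.finrank F L = 10) {r : F}
    (hα : ∀ i j k, i < j → j < k → A.triple (x i) (y j) (y k) = presentationα r i j k)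
    (hβ : ∀ i j k, i < j → j < k → A.triple (y i) (y j) (y k) = presentationβ i j k) :
    A.HasPresentation r := by
  obtain ⟨b, hx, hy⟩ := A.exists_basis_of_standard (n := 5) hn h.form_xx h.form_yy h.form_xy
  refine ⟨b, ⟨⟨?_, ?_, ?_⟩, ?_, ?_, ?_, ?_⟩⟩ <;> simp only [hx, hy]
  · exact h.form_xx
  · exact h.form_yy
  · exact h.form_xy
  · exact h.mul_xx
  · exact h.mul_xy
  · exact hα
  · exact hβ

theorem AdaptedFrame.hasPresentation {A : SAA F L} {x y : Fin 5 → L} (h : A.AdaptedFrame x y)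
    (hn : Module.finrank F L = 10) : ∃ r : F, r ≠ 0 ∧ A.HasPresentation r := by
  obtain ⟨x, y, h, hk⟩ := h.exists_reduced
  obtain ⟨h123, h124, h234, h125, h134, h235, h345, hβ⟩ := h.values
  generalize hp' : A.triple (x 0) (y 1) (y 4) = p at *
  generalize hq' : A.triple (x 0) (y 2) (y 3) = q at *
  generalize ht' : A.triple (x 1) (y 2) (y 4) = t at *
  generalize hm' : A.triple (x 2) (y 3) (y 4) = m at *
  generalize hn' : A.triple (y 0) (y 1) (y 2) = n at *
  -- The scaling factors of the y_i are d₁, …, d₅. Normalising α125, α134, α345 expresses d₁, d₂, d₃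
  -- by d₄ and d₅; normalising β123 then asks for n q² m³ d₄⁵ d₅² = p. Taking d₅ = d₄⁻³ makes this
  -- linear in d₄, with solution c, so no roots are extracted.
  obtain ⟨c, hc⟩ : ∃ c : F, c = n * q ^ 2 * m ^ 3 / p := ⟨_, rfl⟩
  have hc0 : c ≠ 0 := by rw [hc]; simp [h125, h134, h345, hβ]
  have hnc : n = c * p / (q ^ 2 * m ^ 3) := by rw [hc]; field_simp
  have hd : ∀ i, (![q * m / c, q * m * c ^ 2 / p, m / c ^ 2, c, 1 / c ^ 3] : Fin 5 → F) i ≠ 0 := by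
    intro i
    fin_cases i <;> simp [hc0, h125, h134, h345]
  refine ⟨t * (m / c ^ 2) * (1 / c ^ 3) / (q * m * c ^ 2 / p), by simp [hc0, h125, h134, h235, h345],
    (h.toFrame.scale hd).hasPresentation hn (fun i j k hij hjk => ?_) (fun i j k hij hjk => ?_)⟩
  · simp only [triple_smul_left, triple_smul_mid, triple_smul_right]
    fin_cases i <;> fin_cases j <;> first | (exfalso; revert hij; decide) | skip
    all_goals fin_cases k <;> first | (exfalso; revert hjk; decide) | skip
    all_goals simp [presentationα, hk, h123, h124, h234, hp', hq', ht', hm']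
    all_goals field_simp
  · simp only [triple_smul_left, triple_smul_mid, triple_smul_right]
    fin_cases i <;> fin_cases j <;> first | (exfalso; revert hij; decide) | skip
    all_goals fin_cases k <;> first | (exfalso; revert hjk; decide) | skip
    all_goals simp [presentationβ, hk, hn', hnc]
    field_simp

end FrameBasis


open Module

/-! ### Dimensions of the lower central series -/

section Dimension

variable {F : Type u} {L : Type v} [Field F] [AddCommGroup L] [Module F L]

theorem mem_span_singleton_sup {a v : L} {W : Submodule F L} :
    v ∈ Submodule.span F {a} ⊔ W ↔ ∃ c : F, ∃ w ∈ W, v = c • a + w := by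
  rw [Submodule.mem_sup]
  constructor
  · rintro ⟨_, h, w, hw, rfl⟩
    obtain ⟨c, rfl⟩ := Submodule.mem_span_singleton.1 h
    exact ⟨c, w, hw, rfl⟩
  · rintro ⟨c, w, hw, rfl⟩
    exact ⟨c • a, Submodule.smul_mem _ _ (Submodule.mem_span_singleton_self a), w, hw, rfl⟩

theorem finrank_span_singleton_sup_le [FiniteDimensional F L] (a : L) (W : Submodule F L) :
    finrank F (Submodule.span F {a} ⊔ W : Submodule F L) ≤ finrank F W + 1 := by
  have h1 := Submodule.finrank_add_le_finrank_add_finrank (Submodule.span F {a}) W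
  have h2 : finrank F (Submodule.span F {a}) ≤ 1 := (finrank_span_le_card _).trans (by simp)
  omega

theorem eq_span_singleton_sup [FiniteDimensional F L] {V W : Submodule F L} (hWV : W ≤ V)
    (hd : finrank F V ≤ finrank F W + 1) {v : L} (hv : v ∈ V) (hvW : v ∉ W) :
    V = Submodule.span F {v} ⊔ W := by
  symm
  refine Submodule.eq_of_le_of_finrank_le (sup_le (by simpa using hv) hWV) ?_
  have : W < Submodule.span F {v} ⊔ W :=
    lt_of_le_of_ne le_sup_right fun h =>
      hvW (h ▸ Submodule.mem_sup_left (Submodule.mem_span_singleton_self v))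
  have := Submodule.finrank_lt_finrank_of_lt this
  omega

theorem finrank_succ_le [FiniteDimensional F L] {V W : Submodule F L} (hWV : W ≤ V) {v : L}
    (hv : v ∈ V) (hvW : v ∉ W) : finrank F W + 1 ≤ finrank F V :=
  Submodule.finrank_lt_finrank_of_lt (lt_of_le_of_ne hWV fun h => hvW (h ▸ hv))

variable (A : SAA F L)

theorem lcs_stable {k : ℕ} (h : A.lcs (k + 2) = A.lcs (k + 1)) :
    ∀ m, A.lcs (k + 1 + m) = A.lcs (k + 1)
  | 0 => rfl
  | m + 1 => by
    rw [show k + 1 + (m + 1) = (k + m) + 2 by omega, lcs_succ_succ,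
      show k + m + 1 = k + 1 + m by omega, lcs_stable h m, ← lcs_succ_succ, h]

/-- Modulo L³ products depend only on the classes of the factors modulo L², and for two generators
the alternating product leaves only ab. -/
theorem lcs_two_le_of_generators {a b : L}
    (h : (⊤ : Submodule F L) ≤ Submodule.span F {a} ⊔ (Submodule.span F {b} ⊔ A.lcs 2)) :
    A.lcs 2 ≤ Submodule.span F {A.mul a b} ⊔ A.lcs 3 := by
  rw [A.lcs_succ_succ 0, prod_le]
  intro u _ v _
  obtain ⟨c, u', hu', rfl⟩ := mem_span_singleton_sup.1 (h (Submodule.mem_top (x := u)))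
  obtain ⟨d, l, hl, rfl⟩ := mem_span_singleton_sup.1 hu'
  obtain ⟨c', v', hv', rfl⟩ := mem_span_singleton_sup.1 (h (Submodule.mem_top (x := v)))
  obtain ⟨d', l', hl', rfl⟩ := mem_span_singleton_sup.1 hv'
  refine mem_span_singleton_sup.2 ⟨c * d' - d * c',
    A.mul l (c' • a + (d' • b + l')) - A.mul l' (c • a + d • b), ?_, ?_⟩
  · exact sub_mem (A.mul_mem_lcs hl _) (A.mul_mem_lcs hl' _)
  · simp only [map_add, map_smul, LinearMap.add_apply, LinearMap.smul_apply, A.mul_self,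
      A.mul_neg_comm b a, A.mul_neg_comm l' a, A.mul_neg_comm l' b]
    module

/-- Modulo L⁴ only u times a generator counts: u·u = 0, and u times an element of L³ lies in L⁴. -/
theorem lcs_three_le_of_generators {a b u : L}
    (h : (⊤ : Submodule F L) ≤ Submodule.span F {a} ⊔ (Submodule.span F {b} ⊔ A.lcs 2))
    (hu : A.lcs 2 ≤ Submodule.span F {u} ⊔ A.lcs 3) :
    A.lcs 3 ≤ Submodule.span F {A.mul u a} ⊔ (Submodule.span F {A.mul u b} ⊔ A.lcs 4) := by
  rw [A.lcs_succ_succ 1, prod_le]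
  intro p hp v _
  obtain ⟨e, p', hp', rfl⟩ := mem_span_singleton_sup.1 (hu hp)
  obtain ⟨c', v', hv', rfl⟩ := mem_span_singleton_sup.1 (h (Submodule.mem_top (x := v)))
  obtain ⟨d', l', hl', rfl⟩ := mem_span_singleton_sup.1 hv'
  obtain ⟨f, l, hl, rfl⟩ := mem_span_singleton_sup.1 (hu hl')
  refine mem_span_singleton_sup.2 ⟨e * c', _, mem_span_singleton_sup.2 ⟨e * d',
    A.mul p' (c' • a + (d' • b + (f • u + l))) - A.mul l (e • u), ?_, rfl⟩, ?_⟩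
  · exact sub_mem (A.mul_mem_lcs hp' _) (A.mul_mem_lcs hl _)
  · simp only [map_add, map_smul, LinearMap.add_apply, LinearMap.smul_apply, A.mul_self,
      A.mul_neg_comm l u]
    module

/-- The dimensions of the terms of the lower central series of an algebra of dimension `10` and
class `7` with `2`-dimensional centre. -/
theorem finrank_lcs [FiniteDimensional F L] (hdim : finrank F L = 10)
    (hZ : finrank F A.center = 2) (h7 : A.lcs 7 ≠ ⊥) (h8 : A.lcs 8 = ⊥) :
    finrank F (A.lcs 2) = 8 ∧ finrank F (A.lcs 3) = 7 ∧ finrank F (A.lcs 4) = 6 ∧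
      finrank F (A.lcs 5) = 4 ∧ finrank F (A.lcs 6) = 3 ∧ finrank F (A.lcs 7) = 2 := by
  have hperp : ∀ k, finrank F (A.perp (A.lcs k)) = 10 - finrank F (A.lcs k) := fun k => by
    rw [A.finrank_perp, hdim]
  have hle : ∀ k, finrank F (A.lcs k) ≤ 10 := fun k => hdim ▸ Submodule.finrank_le _
  have hlt : ∀ k, 1 ≤ k → k ≤ 7 → finrank F (A.lcs (k + 1)) < finrank F (A.lcs k) := by
    intro k hk hk7
    obtain ⟨k, rfl⟩ := Nat.exists_eq_add_of_le' hk
    refine Submodule.finrank_lt_finrank_of_lt (lt_of_le_of_ne (A.lcs_succ_le _) fun h => h7 ?_)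
    -- Two equal consecutive terms would make the series constant from there on, giving L⁷ = L⁸ = 0.
    have e7 := A.lcs_stable h (6 - k)
    have e8 := A.lcs_stable h (7 - k)
    rw [show k + 1 + (6 - k) = 7 by omega] at e7
    rw [show k + 1 + (7 - k) = 8 by omega] at e8
    rw [e7, ← e8, h8]
  have d2 : finrank F (A.lcs 2) = 8 := by
    have := hperp 2
    rw [← A.center_eq_perp, hZ] at this
    have := hle 2
    omega
  obtain ⟨b, -, hb⟩ : ∃ b ∈ (⊤ : Submodule F L), b ∉ A.lcs 2 := by
    refine SetLike.exists_of_lt (lt_of_le_of_ne le_top fun h => ?_)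
    rw [h, finrank_top] at d2
    omega
  have db : finrank F (Submodule.span F {b} ⊔ A.lcs 2 : Submodule F L) = 9 := by
    have h1 := finrank_span_singleton_sup_le b (A.lcs 2)
    have h2 := finrank_succ_le (le_sup_right : A.lcs 2 ≤ Submodule.span F {b} ⊔ A.lcs 2)
      (Submodule.mem_sup_left (Submodule.mem_span_singleton_self b)) hb
    omega
  obtain ⟨a, -, ha⟩ : ∃ a ∈ (⊤ : Submodule F L), a ∉ Submodule.span F {b} ⊔ A.lcs 2 := by
    refine SetLike.exists_of_lt (lt_of_le_of_ne le_top fun h => ?_)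
    rw [h, finrank_top] at db
    omega
  have hgen : (⊤ : Submodule F L) = Submodule.span F {a} ⊔ (Submodule.span F {b} ⊔ A.lcs 2) :=
    eq_span_singleton_sup le_top (by rw [finrank_top, db, hdim]) trivial ha
  have hu := A.lcs_two_le_of_generators hgen.le
  have d3 : finrank F (A.lcs 3) = 7 := by
    have h1 := Submodule.finrank_mono hu
    have h2 := finrank_span_singleton_sup_le (A.mul a b) (A.lcs 3)
    have h3 : finrank F (A.lcs 3) < finrank F (A.lcs 2) :=
      hlt 2 (by norm_num) (by norm_num)
    omega
  have d4 : 5 ≤ finrank F (A.lcs 4) := by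
    have h1 := Submodule.finrank_mono (A.lcs_three_le_of_generators hgen.le hu)
    have h2 := finrank_span_singleton_sup_le (A.mul (A.mul a b) a)
      (Submodule.span F {A.mul (A.mul a b) b} ⊔ A.lcs 4)
    have h3 := finrank_span_singleton_sup_le (A.mul (A.mul a b) b) (A.lcs 4)
    omega
  have p7 : A.lcs 7 ≤ A.perp (A.lcs 2) := A.lcs_le_perp (i := 6) (j := 1) h8
  have p6 : A.lcs 6 ≤ A.perp (A.lcs 3) := A.lcs_le_perp (i := 5) (j := 2) h8
  have p5 : A.lcs 5 ≤ A.perp (A.lcs 4) := A.lcs_le_perp (i := 4) (j := 3) h8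
  have p4 : A.lcs 4 ≤ A.perp (A.lcs 5) := A.lcs_le_perp (i := 3) (j := 4) h8
  -- As z kills L², the alternating form (z·, ·) factors through L/L² = ⟨a, b⟩, so z not central
  -- means (za, b) ≠ 0. Since (za, a) = 0, the vectors za and zb of L⁷ are then independent, which
  -- gives dim L⁷ ≥ 2; the upper bound is L⁷ ≤ Z(L).
  obtain ⟨z, hz, hzZ⟩ : ∃ z ∈ A.lcs 6, z ∉ A.center := by
    by_contra! h
    refine h7 (eq_bot_iff.2 ((A.prod_le).2 fun u hu v _ => ?_))
    rw [A.mem_center.1 (h u hu) v]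
    exact zero_mem _
  have hz2 : ∀ v ∈ A.lcs 2, A.mul z v = 0 := fun v hv =>
    A.mul_eq_zero_of_lcs (i := 5) (j := 1) h8 hz hv
  have hne : A.triple z a b ≠ 0 := by
    intro h
    apply hzZ
    have hz0 : ∀ u v, A.triple z u v = 0 := by
      intro u v
      obtain ⟨c, u', hu', rfl⟩ := mem_span_singleton_sup.1 (hgen.le (Submodule.mem_top (x := u)))
      obtain ⟨d, l, hl, rfl⟩ := mem_span_singleton_sup.1 hu'
      obtain ⟨c', v', hv', rfl⟩ := mem_span_singleton_sup.1 (hgen.le (Submodule.mem_top (x := v)))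
      obtain ⟨d', l', hl', rfl⟩ := mem_span_singleton_sup.1 hv'
      have hl0 : ∀ w, A.triple z l w = 0 := fun w => by simp [triple, hz2 l hl]
      have hl0' : ∀ w, A.triple z w l' = 0 := fun w => by
        rw [triple_swap_right]; simp [triple, hz2 l' hl']
      simp only [triple_add_mid, triple_add_right, triple_smul_mid, triple_smul_right, hl0, hl0',
        triple_self_right, A.triple_swap_right z b a, h]
      ring
    exact A.mem_center.2 fun u => A.eq_zero_of_form fun v => hz0 u v
  have d7 : finrank F (A.lcs 7) = 2 := by
    have h1 := Submodule.finrank_mono p7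
    have h2 : finrank F (Submodule.span F {A.mul z a}) = 1 := finrank_span_singleton fun h0 =>
      hne (by simp [triple, h0])
    have h3 := finrank_succ_le (W := Submodule.span F {A.mul z a}) (V := A.lcs 7)
      (v := A.mul z b) (by simpa using A.mul_mem_lcs hz a) (A.mul_mem_lcs hz b) (by
        intro h
        obtain ⟨c, hc⟩ := Submodule.mem_span_singleton.1 h
        apply hne
        rw [triple_swap_right, triple, ← hc, map_smul, LinearMap.smul_apply]
        have := A.triple_self_right z a
        rw [triple] at this
        rw [this]; simp)
    have := hperp 2
    omega
  have d6 : finrank F (A.lcs 6) = 3 := by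
    have h1 := Submodule.finrank_mono p6
    have h2 : finrank F (A.lcs 7) < finrank F (A.lcs 6) :=
      hlt 6 (by norm_num) (by norm_num)
    have := hperp 3
    omega
  -- If dim L⁴ = 5, then L⁵ has codimension 1 in L⁴. As L⁴ ⊥ L⁵ and the form is alternating, L⁴ is
  -- isotropic, hence L⁵ ⊥ L³; but dim L⁵ = 4 while the complement of L³ has dimension 3.
  have d45 : finrank F (A.lcs 4) ≠ 5 := by
    intro h5
    have h1 : finrank F (A.lcs 5) < finrank F (A.lcs 4) :=
      hlt 4 (by norm_num) (by norm_num)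
    have h2 : finrank F (A.lcs 6) < finrank F (A.lcs 5) :=
      hlt 5 (by norm_num) (by norm_num)
    obtain ⟨s, hs, hs5⟩ := SetLike.exists_of_lt (lt_of_le_of_ne (A.lcs_succ_le 4)
      fun h => by rw [show A.lcs 5 = A.lcs 4 from h] at h1; omega)
    have hspan := eq_span_singleton_sup (W := A.lcs 5) (A.lcs_succ_le 4) (by omega) hs hs5
    have hiso : A.lcs 4 ≤ A.perp (A.lcs 4) := by
      intro p hp
      rw [mem_perp]
      intro q hq
      have hs4 := A.mem_perp.1 (p4 hs)
      rw [hspan] at hp hq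
      obtain ⟨c, l, hl, rfl⟩ := mem_span_singleton_sup.1 hp
      obtain ⟨c', l', hl', rfl⟩ := mem_span_singleton_sup.1 hq
      have e1 : A.form l s = 0 := by rw [form_neg, hs4 l hl, neg_zero]
      have e2 : A.form l l' = 0 := A.mem_perp.1 (p4 (A.lcs_succ_le 4 hl)) l' hl'
      simp [A.form_self, hs4 l' hl', e1, e2]
    have h5' : A.lcs 5 ≤ A.perp (A.lcs 3) := by
      rw [A.lcs_succ_succ 3]; exact A.prod_top_le_perp.2 hiso
    have := Submodule.finrank_mono h5'
    have := hperp 3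
    omega
  have h3 : finrank F (A.lcs 4) < finrank F (A.lcs 3) :=
      hlt 3 (by norm_num) (by norm_num)
  have h5 : finrank F (A.lcs 6) < finrank F (A.lcs 5) :=
      hlt 5 (by norm_num) (by norm_num)
  have h45 := Submodule.finrank_mono p5
  have := hperp 4
  exact ⟨d2, d3, by omega, by omega, d6, d7⟩

end Dimension


/-! ### Completing an isotropic chain to a frame -/

section Completion

variable {F : Type u} {L : Type v} [Field F] [AddCommGroup L] [Module F L]

/-- An isotropic linearly independent family is one half of a standard basis. -/
theorem exists_dual_family [FiniteDimensional F L] (A : SAA F L) {n : ℕ} {x : Fin n → L}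
    (hx : LinearIndependent F x) (hxx : ∀ i j, A.form (x i) (x j) = 0) :
    ∃ y : Fin n → L, (∀ i j, A.form (y i) (y j) = 0) ∧
      ∀ i j, A.form (x i) (y j) = if i = j then 1 else 0 := by
  have hdual : ∀ j, ∃ y, ∀ i, A.form (x i) y = if i = j then 1 else 0 := by
    intro j
    -- A dual vector z_j represents an extension of the j-th coordinate functional on the span of
    -- the x_i.
    obtain ⟨g, hg⟩ := LinearMap.exists_extend ((Finsupp.lapply j).comp hx.repr)
    refine ⟨-(LinearMap.BilinForm.toDual A.form A.form_nondegenerate).symm g, fun i => ?_⟩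
    rw [form_neg, map_neg, LinearMap.neg_apply, neg_neg,
      LinearMap.BilinForm.apply_toDual_symm_apply]
    have hi : x i ∈ Submodule.span F (Set.range x) := Submodule.subset_span ⟨i, rfl⟩
    have := LinearMap.congr_fun hg ⟨x i, hi⟩
    rw [LinearMap.comp_apply, LinearMap.comp_apply, hx.repr_eq_single i ⟨x i, hi⟩ rfl,
      Finsupp.lapply_apply, Finsupp.single_apply] at this
    exact this
  choose z hz using hdual
  have hz' : ∀ i j, A.form (z i) (x j) = if i = j then -1 else 0 := fun i j => by
    rw [form_neg, hz]; split_ifs <;> simp_all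
  -- Each pair of the z_j is corrected on one side only, which avoids halving the correction and so
  -- works in characteristic 2.
  refine ⟨fun j => z j + ∑ i, (if j < i then A.form (z i) (z j) else 0) • x i,
    fun i j => ?_, fun i j => ?_⟩
  · simp only [map_add, LinearMap.add_apply, map_sum, map_smul, LinearMap.sum_apply,
      LinearMap.smul_apply, hz, hz', hxx, smul_eq_mul, mul_ite, mul_zero, mul_one, mul_neg,
      Finset.sum_ite_eq, Finset.sum_ite_eq', Finset.mem_univ, if_true, Finset.sum_const_zero,
      add_zero]
    rcases lt_trichotomy i j with h | rfl | h
    · simp [h, h.not_gt, A.form_neg (z j) (z i)]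
    · simp [A.form_self]
    · simp [h, h.not_gt, A.form_neg (z i) (z j)]
  · simp only [map_add, map_sum, map_smul, hz, hxx, smul_zero, Finset.sum_const_zero, add_zero]

/-- An isotropic family that spans a suitable chain of ideals extends to a frame. -/
theorem exists_frame_of_chain [FiniteDimensional F L] (A : SAA F L) {x : Fin 5 → L}
    (hx : LinearIndependent F x) (hxx : ∀ i j, A.form (x i) (x j) = 0)
    (hmul : ∀ i w, A.mul (x i) w ∈ Submodule.span F (x '' Set.Ioi i)) :
    ∃ y, A.Frame x y := by
  obtain ⟨y, hyy, hxy⟩ := A.exists_dual_family hx hxx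
  have hspan : ∀ i (g : L →ₗ[F] F), (∀ j, i < j → g (x j) = 0) →
      ∀ w, g (A.mul (x i) w) = 0 := by
    intro i g hg w
    have : Submodule.span F (x '' Set.Ioi i) ≤ LinearMap.ker g := by
      rw [Submodule.span_le]
      rintro _ ⟨j, hj, rfl⟩
      exact hg j hj
    exact this (hmul i w)
  refine ⟨y, hxx, hyy, hxy, fun i j => A.eq_zero_of_form fun w => ?_,
    fun i j hij => A.eq_zero_of_form fun w => ?_⟩
  -- (x_i x_j, w) = (x_j w, x_i) vanishes because x_j w lies in the isotropic span of the x_k. In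
  -- the second case (x_i y_j, w) is up to sign (x_i w, y_j), and x_i w only involves x_k with k > i
  -- ≥ j.
  · rw [A.form_mul]
    exact hspan j (A.form.flip (x i)) (fun k _ => hxx k i) w
  · rw [A.form_mul, A.form_mul, A.mul_neg_comm, map_neg, LinearMap.neg_apply, neg_eq_zero]
    refine hspan i (A.form.flip (y j)) (fun k hk => ?_) w
    rw [LinearMap.flip_apply, hxy, if_neg (hij.trans_lt hk).ne']

end Completion

/-! ### Coordinates with respect to a frame -/

section Expansion

variable {F : Type u} {L : Type v} [Field F] [AddCommGroup L] [Module F L]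
variable {A : SAA F L} {x y : Fin 5 → L}

theorem Frame.expand (h : A.Frame x y) (hn : finrank F L = 10) (v : L) :
    v = ∑ i, A.form v (y i) • x i - ∑ i, A.form v (x i) • y i := by
  obtain ⟨b, hx, hy⟩ := A.exists_basis_of_standard (n := 5) hn h.form_xx h.form_yy h.form_xy
  rw [← sub_eq_zero]
  apply A.form_nondegenerate.2
  intro u
  rw [form_neg, neg_eq_zero]
  suffices A.form (v - (∑ i, A.form v (y i) • x i - ∑ i, A.form v (x i) • y i)) = 0 by
    rw [this]; rfl
  apply b.ext
  rintro (i | i)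
  · simp [hx, h.form_xx, h.form_yx]
  · simp [hy, h.form_xy, h.form_yy]

theorem Frame.eq_zero (h : A.Frame x y) (hn : finrank F L = 10) {v : L}
    (hx : ∀ i, A.form v (x i) = 0) (hy : ∀ i, A.form v (y i) = 0) : v = 0 := by
  rw [h.expand hn v]
  simp [hx, hy]

end Expansion


/-! ### An adapted frame from the characteristic subspaces -/

section Adapted

variable {F : Type u} {L : Type v} [Field F] [AddCommGroup L] [Module F L]

theorem mem_perp_of_forall_mul_eq_zero (A : SAA F L) {k : ℕ} {p : L}
    (h : ∀ v ∈ A.lcs (k + 1), A.mul p v = 0) : p ∈ A.perp (A.lcs (k + 2)) := by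
  have : A.prod (Submodule.span F {p}) (A.lcs (k + 1)) ≤ A.perp ⊤ := by
    rw [prod_le]
    intro u hu v hv
    obtain ⟨c, rfl⟩ := Submodule.mem_span_singleton.1 hu
    simp [h v hv]
  rw [prod_le_perp, ← lcs_succ_succ, le_perp_comm] at this
  exact this (Submodule.mem_span_singleton_self p)

variable {A : SAA F L}

/-- For k = 1 the intersection in the definition of the index is I₁ itself. -/
theorem indexI_eq_one (A : SAA F L) (hle : A.prod (A.lcs 5) (A.lcs 2) ≤ A.prod (A.lcs 4) (A.lcs 3))
    (hne : A.prod (A.lcs 5) (A.lcs 2) ≠ ⊥) : A.indexI = 1 := by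
  have h1 : 1 ∈ {k : ℕ | 1 ≤ k ∧ k ≤ 3 ∧ A.idealI k ⊓ A.prod (A.lcs 4) (A.lcs 3) ≠ ⊥} := by
    refine ⟨le_rfl, by norm_num, ?_⟩
    change A.prod (A.lcs 5) (A.lcs 2) ⊓ _ ≠ ⊥
    rwa [inf_eq_left.2 hle]
  exact le_antisymm (Nat.sInf_le h1) (Nat.sInf_mem ⟨1, h1⟩).1

theorem HasProperties.lcs_eight (h : A.HasProperties) : A.lcs 8 = ⊥ := h.class_eq.1

theorem HasProperties.lcs_seven_ne (h : A.HasProperties) : A.lcs 7 ≠ ⊥ := fun h7 => by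
  have := h.class_eq.2 (show A.lcs (6 + 1) = ⊥ from h7)
  omega

theorem HasProperties.exists_adaptedFrame (h : A.HasProperties) :
    ∃ x y : Fin 5 → L, A.AdaptedFrame x y := by
  have hdim := h.dim_eq
  have : FiniteDimensional F L := FiniteDimensional.of_finrank_pos (by omega)
  have h8 := h.lcs_eight
  obtain ⟨d2, d3, d4, d5, d6, d7⟩ := A.finrank_lcs hdim h.dim_center h.lcs_seven_ne h8
  have hperp : ∀ k, finrank F (A.perp (A.lcs k)) = 10 - finrank F (A.lcs k) := fun k => by
    rw [A.finrank_perp, hdim]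
  have p2 : A.lcs 2 = A.perp (A.lcs 7) := Submodule.eq_of_le_of_finrank_le
    (A.lcs_le_perp (i := 1) (j := 6) h8) (by rw [hperp, d2, d7])
  have p3 : A.lcs 3 = A.perp (A.lcs 6) := Submodule.eq_of_le_of_finrank_le
    (A.lcs_le_perp (i := 2) (j := 5) h8) (by rw [hperp, d3, d6])
  have p4 : A.lcs 4 = A.perp (A.lcs 5) := Submodule.eq_of_le_of_finrank_le
    (A.lcs_le_perp (i := 3) (j := 4) h8) (by rw [hperp, d4, d5])
  have p5 : A.lcs 5 = A.perp (A.lcs 4) := Submodule.eq_of_le_of_finrank_le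
    (A.lcs_le_perp (i := 4) (j := 3) h8) (by rw [hperp, d4, d5])
  have p7 : A.lcs 7 = A.perp (A.lcs 2) := Submodule.eq_of_le_of_finrank_le
    (A.lcs_le_perp (i := 6) (j := 1) h8) (by rw [hperp, d2, d7])
  have m44 : ∀ u ∈ A.lcs 4, ∀ v ∈ A.lcs 4, A.mul u v = 0 := fun u hu v hv =>
    A.mul_eq_zero_of_lcs (i := 3) (j := 3) h8 hu hv
  have m53 : ∀ u ∈ A.lcs 5, ∀ v ∈ A.lcs 3, A.mul u v = 0 := fun u hu v hv =>
    A.mul_eq_zero_of_lcs (i := 4) (j := 2) h8 hu hv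
  have m62 : ∀ u ∈ A.lcs 6, ∀ v ∈ A.lcs 2, A.mul u v = 0 := fun u hu v hv =>
    A.mul_eq_zero_of_lcs (i := 5) (j := 1) h8 hu hv
  have hext : ∀ {V W : Submodule F L}, W ≤ V → finrank F V = finrank F W + 1 →
      ∃ v ∈ V, v ∉ W ∧ V = Submodule.span F {v} ⊔ W := by
    intro V W hWV hd
    obtain ⟨v, hv, hvW⟩ := SetLike.exists_of_lt (lt_of_le_of_ne hWV fun he => by
      rw [he] at hd; omega)
    exact ⟨v, hv, hvW, eq_span_singleton_sup hWV hd.le hv hvW⟩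
  obtain ⟨t, ht, ht6, s5⟩ := hext (A.lcs_succ_le 5) (by rw [d6, d5])
  obtain ⟨z, hz, hz7, s6⟩ := hext (A.lcs_succ_le 6) (by rw [d6, d7])
  obtain ⟨u, hu, hu3, s2⟩ := hext (A.lcs_succ_le 2) (by rw [d2, d3])
  obtain ⟨w, hw, hw4, s3⟩ := hext (A.lcs_succ_le 3) (by rw [d3, d4])
  change t ∉ A.lcs 6 at ht6
  change z ∉ A.lcs 7 at hz7
  change u ∉ A.lcs 3 at hu3
  change w ∉ A.lcs 4 at hw4
  change A.lcs 5 = _ ⊔ A.lcs 6 at s5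
  change A.lcs 6 = _ ⊔ A.lcs 7 at s6
  change A.lcs 2 = _ ⊔ A.lcs 3 at s2
  change A.lcs 3 = _ ⊔ A.lcs 4 at s3
  -- the ideal `L⁵L²` is spanned by `t u`
  have hI : A.prod (A.lcs 5) (A.lcs 2) ≤ Submodule.span F {A.mul t u} := by
    rw [prod_le]
    intro p hp q hq
    have hp2 := hq
    rw [s5] at hp
    rw [s2] at hq
    obtain ⟨c, p', hp', rfl⟩ := mem_span_singleton_sup.1 hp
    obtain ⟨d, q', hq', rfl⟩ := mem_span_singleton_sup.1 hq
    refine Submodule.mem_span_singleton.2 ⟨c * d, ?_⟩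
    rw [map_add A.mul, LinearMap.add_apply, m62 p' hp' _ hp2]
    simp [m53 t ht q' hq', mul_smul]
  -- L⁵L² = 0 would mean L³ = L²L ⊥ L⁵, but dim L³ = 7 and the complement of L⁵ has dimension 6.
  have htu : A.mul t u ≠ 0 := by
    intro h0
    rw [h0, Submodule.span_zero_singleton, le_bot_iff] at hI
    have : A.lcs 3 ≤ A.perp (A.lcs 5) := by
      rw [A.lcs_succ_succ 1, ← prod_le_perp, hI]
      exact bot_le
    have := Submodule.finrank_mono this
    rw [hperp] at this
    omega
  have hmem : A.mul t u ∈ A.prod (A.lcs 5) (A.lcs 2) := A.mem_prod ht hu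
  have hIne : A.prod (A.lcs 5) (A.lcs 2) ≠ ⊥ := fun h0 => htu (by simpa [h0] using hmem)
  have hI1 : A.idealI A.indexI = A.prod (A.lcs 5) (A.lcs 2) := by
    rw [A.indexI_eq_one h.le hIne]; rfl
  have htu7 : A.mul t u ∈ A.lcs 7 := by
    rw [p7, mem_perp]
    intro q hq
    rw [s2] at hq
    obtain ⟨d, q', hq', rfl⟩ := mem_span_singleton_sup.1 hq
    have e1 := A.triple_self_right t u
    have e2 := A.triple_swap_right t u q'
    simp only [triple, m53 t ht q' hq'] at e1 e2
    simp [e1, e2]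
  -- As L⁴L⁴ = 0, only w counts in L³, so every element of L⁴L³ is a single product pw. Hence L⁵L² ≤
  -- L⁴L³ supplies e ∈ L⁴ with ew = tu; this e becomes x₁.
  have h43 : A.prod (A.lcs 4) (A.lcs 3) ≤ (A.lcs 4).map (A.mul.flip w) := by
    rw [prod_le]
    intro p hp q hq
    rw [s3] at hq
    obtain ⟨d, q', hq', rfl⟩ := mem_span_singleton_sup.1 hq
    exact ⟨d • p, Submodule.smul_mem _ _ hp, by simp [m44 p hp q' hq']⟩
  obtain ⟨e, he, hew⟩ := h43 (h.le hmem)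
  rw [LinearMap.flip_apply] at hew
  have he5 : e ∉ A.lcs 5 := fun h5 => htu (by rw [← hew, m53 e h5 w hw])
  have d5' : finrank F (Submodule.span F {A.mul t u}) = 1 := finrank_span_singleton htu
  obtain ⟨z', hz', hz'5, s7⟩ := hext (W := Submodule.span F {A.mul t u}) (V := A.lcs 7)
    (by simpa using htu7) (by rw [d7, d5'])
  -- the vectors `x₁, …, x₅`
  set x : Fin 5 → L := ![e, t, z, z', A.mul t u] with hx
  have x0 : x 0 = e := rfl
  have x1 : x 1 = t := rfl
  have x2 : x 2 = z := rfl
  have x3 : x 3 = z' := rfl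
  have x4 : x 4 = A.mul t u := rfl
  have sp7 : Submodule.span F (x '' Set.Ioi 2) = A.lcs 7 := by
    have : (Set.Ioi 2 : Set (Fin 5)) = {3, 4} := by ext i; fin_cases i <;> simp
    rw [this, Set.image_insert_eq, Set.image_singleton, Submodule.span_insert, s7, x3, x4]
  have sp6 : Submodule.span F (x '' Set.Ioi 1) = A.lcs 6 := by
    have : (Set.Ioi 1 : Set (Fin 5)) = insert 2 (Set.Ioi 2) := by ext i; fin_cases i <;> simp
    rw [this, Set.image_insert_eq, Submodule.span_insert, sp7, s6, x2]
  have sp5 : Submodule.span F (x '' Set.Ioi 0) = A.lcs 5 := by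
    have : (Set.Ioi 0 : Set (Fin 5)) = insert 1 (Set.Ioi 1) := by ext i; fin_cases i <;> simp
    rw [this, Set.image_insert_eq, Submodule.span_insert, sp6, s5, x1]
  have x5mem : ∀ i, 0 < i → x i ∈ A.lcs 5 := fun i hi => by
    rw [← sp5]; exact Submodule.subset_span ⟨i, hi, rfl⟩
  have x6mem : ∀ i, 1 < i → x i ∈ A.lcs 6 := fun i hi => by
    rw [← sp6]; exact Submodule.subset_span ⟨i, hi, rfl⟩
  have x7mem : ∀ i, 2 < i → x i ∈ A.lcs 7 := fun i hi => by
    rw [← sp7]; exact Submodule.subset_span ⟨i, hi, rfl⟩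
  have x4mem : ∀ i, x i ∈ A.lcs 4 := fun i => by
    rcases eq_or_ne i 0 with rfl | hi
    · exact he
    · exact A.lcs_succ_le 4 (x5mem i (Fin.pos_of_ne_zero hi))
  have hli : LinearIndependent F x := by
    rw [linearIndependent_iff_card_le_finrank_span, Fintype.card_fin, Set.finrank]
    have : Set.range x = insert (x 0) (x '' Set.Ioi 0) := by
      rw [← Set.image_univ, ← Set.image_insert_eq]
      congr 1
      ext i; fin_cases i <;> simp
    rw [this, Submodule.span_insert, sp5]
    have := finrank_succ_le (le_sup_right : A.lcs 5 ≤ Submodule.span F {x 0} ⊔ A.lcs 5)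
      (Submodule.mem_sup_left (Submodule.mem_span_singleton_self _)) he5
    omega
  have hxx : ∀ i j, A.form (x i) (x j) = 0 := by
    intro i j
    rcases eq_or_ne i 0 with rfl | hi
    · rcases eq_or_ne j 0 with rfl | hj
      · exact A.form_self _
      · rw [p4] at he
        exact A.mem_perp.1 he _ (x5mem j (Fin.pos_of_ne_zero hj))
    · have := x5mem i (Fin.pos_of_ne_zero hi)
      rw [p5] at this
      exact A.mem_perp.1 this _ (x4mem j)
  have hmul : ∀ i v, A.mul (x i) v ∈ Submodule.span F (x '' Set.Ioi i) := by
    intro i v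
    fin_cases i
    · change A.mul (x 0) v ∈ Submodule.span F (x '' Set.Ioi 0)
      rw [sp5]; exact A.mul_mem_lcs he v
    · change A.mul (x 1) v ∈ Submodule.span F (x '' Set.Ioi 1)
      rw [sp6]; exact A.mul_mem_lcs ht v
    · change A.mul (x 2) v ∈ Submodule.span F (x '' Set.Ioi 2)
      rw [sp7]; exact A.mul_mem_lcs hz v
    · have := A.mul_mem_lcs (x7mem 3 (by decide)) v
      rw [h8, Submodule.mem_bot] at this
      change A.mul (x 3) v ∈ _
      rw [this]; exact zero_mem _
    · have := A.mul_mem_lcs (x7mem 4 (by decide)) v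
      rw [h8, Submodule.mem_bot] at this
      change A.mul (x 4) v ∈ _
      rw [this]; exact zero_mem _
  obtain ⟨y, hf⟩ := A.exists_frame_of_chain hli hxx hmul
  have hr := hf.rules
  have hperp_of : ∀ (i j : Fin 5), j ≤ i → y j ∈ A.perp (Submodule.span F (x '' Set.Ioi i)) := by
    intro i j hij
    rw [← Submodule.span_singleton_le_iff_mem, le_perp_comm, Submodule.span_le]
    rintro _ ⟨k, hk, rfl⟩
    refine A.mem_perp.2 fun v hv => ?_
    obtain ⟨c, rfl⟩ := Submodule.mem_span_singleton.1 hv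
    simp [hf.form_xy, (hij.trans_lt hk).ne']
  have y2 : y 2 ∈ A.lcs 2 := by rw [p2, ← sp7]; exact hperp_of 2 2 le_rfl
  have y1 : y 1 ∈ A.lcs 3 := by rw [p3, ← sp6]; exact hperp_of 1 1 le_rfl
  have y0 : y 0 ∈ A.lcs 4 := by rw [p4, ← sp5]; exact hperp_of 0 0 le_rfl
  -- `x₁y₂` and `x₂y₃` are multiples of `x₅`
  obtain ⟨c, hc0, hc⟩ : ∃ c : F, c ≠ 0 ∧ ∃ l ∈ A.lcs 4, y 1 = c • w + l := by
    have := y1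
    rw [s3] at this
    obtain ⟨c, l, hl, hl'⟩ := mem_span_singleton_sup.1 this
    refine ⟨c, fun h0 => ?_, l, hl, hl'⟩
    rw [h0, zero_smul, zero_add] at hl'
    rw [← hl', p4] at hl
    have := A.mem_perp.1 hl _ (x5mem 1 (by decide))
    simp [hf.form_yx] at this
  obtain ⟨l, hl, hyl⟩ := hc
  have hx1y2 : A.mul (x 0) (y 1) = c • x 4 := by
    rw [hyl, x0, map_add, map_smul, hew, m44 e he l hl, add_zero, x4]
  obtain ⟨d, hd0, hd⟩ : ∃ d : F, d ≠ 0 ∧ A.mul (x 1) (y 2) = d • x 4 := by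
    have := y2
    rw [s2] at this
    obtain ⟨d, l, hl, hl'⟩ := mem_span_singleton_sup.1 this
    refine ⟨d, fun h0 => ?_, ?_⟩
    · rw [h0, zero_smul, zero_add] at hl'
      rw [← hl', p3] at hl
      have := A.mem_perp.1 hl _ (x6mem 2 (by decide))
      simp [hf.form_yx] at this
    · rw [hl', x1, map_add, map_smul, m53 t ht l hl, add_zero, x4]
  have α123 : A.triple (x 0) (y 1) (y 2) = 0 := by simp [triple, hx1y2, hf.form_xy]
  have hw' : w = c⁻¹ • (y 1 - l) := by rw [hyl]; simp [smul_smul, hc0]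
  have hy0w : A.mul (y 0) w = c⁻¹ • A.mul (y 0) (y 1) := by
    rw [hw', map_smul, map_sub, m44 _ y0 l hl, sub_zero]
  -- L⁴L³ is spanned by x₁w = x₅ and y₁w. If β123 = 0, then y₁w ∈ L⁷. It is not in ⟨x₅⟩, since
  -- otherwise some y₁ - k x₁ would kill L³ and so be orthogonal to L⁴ ∋ x₁. Then L⁴L³ = L⁷, which
  -- is excluded.
  have hβ : A.triple (y 0) (y 1) (y 2) ≠ 0 := by
    intro hβ
    have hy7 : A.mul (y 0) w ∈ A.lcs 7 := by
      rw [hy0w, hf.expand hdim (A.mul (y 0) (y 1))]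
      change c⁻¹ • (∑ i, A.triple _ _ _ • _ - ∑ i, A.triple _ _ _ • _) ∈ _
      simp only [Fin.sum_univ_five]
      simp only [hβ, hr, A.triple_swap_right (y 0) (y 1) (y 0), zero_smul, neg_zero, zero_add,
        add_zero, le_refl, Fin.zero_le, sub_zero]
      exact Submodule.smul_mem _ _ (add_mem (Submodule.smul_mem _ _ (x7mem 3 (by decide)))
        (Submodule.smul_mem _ _ (x7mem 4 (by decide))))
    have hy5 : A.mul (y 0) w ∉ Submodule.span F {A.mul t u} := by
      intro hk
      obtain ⟨k, hk⟩ := Submodule.mem_span_singleton.1 hk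
      have hzero : ∀ v ∈ A.lcs 3, A.mul (y 0 - k • e) v = 0 := by
        intro v hv
        have hm : y 0 - k • e ∈ A.lcs 4 := sub_mem y0 (Submodule.smul_mem _ _ he)
        rw [s3] at hv
        obtain ⟨c, l, hl, rfl⟩ := mem_span_singleton_sup.1 hv
        rw [map_add, m44 _ hm l hl, map_smul, map_sub, map_smul, LinearMap.sub_apply,
          LinearMap.smul_apply, hew, hk]
        simp
      have := A.mem_perp.1 (A.mem_perp_of_forall_mul_eq_zero (k := 2) hzero) e he
      rw [map_sub, map_smul, LinearMap.sub_apply, LinearMap.smul_apply, A.form_self, ← x0,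
        hf.form_yx] at this
      simp at this
    apply h.ne
    apply le_antisymm
    · refine h43.trans ?_
      rintro _ ⟨p, hp, rfl⟩
      change p ∈ A.lcs 4 at hp
      rw [LinearMap.flip_apply]
      rw [p4] at hp
      rw [hf.expand hdim p]
      have hxw : ∀ i, 0 < i → A.mul (x i) w = 0 := fun i hi => m53 _ (x5mem i hi) w hw
      simp only [Fin.sum_univ_five, A.mem_perp.1 hp _ (x5mem 1 (by decide)),
        A.mem_perp.1 hp _ (x5mem 2 (by decide)), A.mem_perp.1 hp _ (x5mem 3 (by decide)),
        A.mem_perp.1 hp _ (x5mem 4 (by decide)), zero_smul, add_zero, map_sub, map_add, map_smul,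
        LinearMap.sub_apply, LinearMap.add_apply, LinearMap.smul_apply,
        hxw 1 (by decide), hxw 2 (by decide), hxw 3 (by decide), hxw 4 (by decide), smul_zero]
      rw [x0, hew]
      exact sub_mem (Submodule.smul_mem _ _ htu7) (Submodule.smul_mem _ _ hy7)
    · rw [eq_span_singleton_sup (by simpa using htu7) (by rw [d7, d5']) hy7 hy5]
      refine sup_le ?_ ?_ <;> rw [Submodule.span_singleton_le_iff_mem]
      · exact A.mem_prod y0 hw
      · exact h.le hmem
  refine ⟨x, y, hf, α123, ?_, ?_, ?_, fun α134 => ?_, ?_, fun α345 => ?_, hβ⟩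
  · simp [triple, hx1y2, hf.form_xy]
  · simp [triple, hd, hf.form_xy]
  · simp [triple, hx1y2, hf.form_xy, hc0]
  -- With α134 = 0 all of x₁y₂, x₁y₃, x₂y₃ lie in ⟨x₅⟩. Since β123 ≠ 0, elements of U have no
  -- y₁-component, so UL² ≤ ⟨x₅⟩, against dim UL² = 2.
  · have hx1y3 : A.mul (x 0) (y 2) ∈ Submodule.span F {x 4} := by
      rw [hf.expand hdim (A.mul (x 0) (y 2))]
      change (∑ i, A.triple _ _ _ • _ - ∑ i, A.triple _ _ _ • _) ∈ _
      simp only [Fin.sum_univ_five]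
      simp [hr, α123, α134]
      exact Submodule.smul_mem _ _ (Submodule.mem_span_singleton_self _)
    have hUL : A.prod A.subspaceU (A.lcs 2) ≤ Submodule.span F {x 4} := by
      rw [prod_le]
      rintro q ⟨hq4, hqU⟩ v hv
      rw [hI1] at hqU
      have hqy := hI (hqU _ y1)
      rw [p4] at hq4
      rw [p2] at hv
      have hq : q = A.form q (y 0) • x 0 + A.form q (y 1) • x 1 + A.form q (y 2) • x 2 +
          A.form q (y 3) • x 3 + A.form q (y 4) • x 4 - A.form q (x 0) • y 0 := by
        conv_lhs => rw [hf.expand hdim q]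
        simp only [Fin.sum_univ_five, A.mem_perp.1 hq4 _ (x5mem 1 (by decide)),
          A.mem_perp.1 hq4 _ (x5mem 2 (by decide)), A.mem_perp.1 hq4 _ (x5mem 3 (by decide)),
          A.mem_perp.1 hq4 _ (x5mem 4 (by decide)), zero_smul, add_zero]
      have hq0 : A.form q (x 0) = 0 := by
        obtain ⟨k, hk⟩ := Submodule.mem_span_singleton.1 hqy
        have h1 : A.triple q (y 1) (y 2) = 0 := by
          rw [triple, ← hk, ← x4]
          simp [hf.form_xy]
        rw [hq] at h1
        simpa [triple_sub_left, triple_add_left, triple_smul_left, hr, α123, hβ] using h1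
      have hv : v = A.form v (y 0) • x 0 + A.form v (y 1) • x 1 + A.form v (y 2) • x 2 +
          A.form v (y 3) • x 3 + A.form v (y 4) • x 4 - (A.form v (x 0) • y 0 +
          A.form v (x 1) • y 1 + A.form v (x 2) • y 2) := by
        conv_lhs => rw [hf.expand hdim v]
        simp only [Fin.sum_univ_five, A.mem_perp.1 hv _ (x7mem 3 (by decide)),
          A.mem_perp.1 hv _ (x7mem 4 (by decide)), zero_smul, add_zero]
      have e5 := Submodule.mem_span_singleton_self (R := F) (x 4)
      rw [hq, hv, hq0]
      simp only [map_add, map_sub, map_smul, LinearMap.add_apply, LinearMap.sub_apply,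
        LinearMap.smul_apply, hf.mul_xx, hx1y2, hd]
      simp [hf.mul_xy]
      have e := fun a : F => Submodule.smul_mem _ a e5
      exact add_mem (add_mem (neg_mem (Submodule.smul_mem _ _ (Submodule.smul_mem _ _ (e _))))
        (neg_mem (Submodule.smul_mem _ _ (Submodule.smul_mem _ _ hx1y3))))
        (neg_mem (Submodule.smul_mem _ _ (Submodule.smul_mem _ _ (e _))))
    have := Submodule.finrank_mono hUL
    have h1 : finrank F (Submodule.span F {x 4}) = 1 := finrank_span_singleton htu
    rw [h.dim_UL2, h1] at this
    omega
  · simp [triple, hd, hf.form_xy, hd0]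
  -- α345 is the only value left that involves x₃; without it x₃ = z would be central, but Z(L) =
  -- L⁷.
  · have hz0 : ∀ v, A.mul (x 2) v = 0 := by
      have h3 : A.mul (x 2) (y 3) = 0 := by
        refine hf.eq_zero hdim (fun i => hr.2.1 2 i _) fun i => ?_
        change A.triple _ _ _ = 0
        fin_cases i <;> simp [hr, α345]
      have h4 : A.mul (x 2) (y 4) = 0 := by
        refine hf.eq_zero hdim (fun i => hr.2.1 2 i _) fun i => ?_
        change A.triple _ _ _ = 0
        fin_cases i <;> simp [hr, α345]
      intro v
      rw [hf.expand hdim v]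
      simp [Fin.sum_univ_five, hf.mul_xx, hf.mul_xy, h3, h4]
    apply hz7
    rw [p7, ← A.center_eq_perp]
    exact A.mem_center.2 hz0

end Adapted


/-! ### Product table, isomorphism and rescaling of presented algebras -/

section Presented

variable {F : Type u} {L : Type v} [Field F] [AddCommGroup L] [Module F L]

/-- A frame with the values of the trilinear form prescribed by the presentation. -/
structure PresentedFrame (A : SAA F L) (r : F) (x y : Fin 5 → L) : Prop extends A.Frame x y where
  xyy : ∀ i j k, i < j → j < k → A.triple (x i) (y j) (y k) = presentationα r i j k
  yyy : ∀ i j k, i < j → j < k → A.triple (y i) (y j) (y k) = presentationβ i j k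

theorem HasNilpotentPresentation.presentedFrame {A : SAA F L} {r : F}
    {b : Basis (Fin 5 ⊕ Fin 5) F L}
    (h : A.HasNilpotentPresentation b (presentationα r) presentationβ) :
    A.PresentedFrame r (fun i => b (Sum.inl i)) (fun i => b (Sum.inr i)) where
  form_xx := h.standard.form_x_x
  form_yy := h.standard.form_y_y
  form_xy := h.standard.form_x_y
  mul_xx := h.x_mul_x
  mul_xy := h.x_mul_y
  xyy := h.xyy
  yyy := h.yyy

theorem finrank_of_basis (b : Basis (Fin 5 ⊕ Fin 5) F L) : finrank F L = 10 := by
  rw [finrank_eq_card_basis b]; rfl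

theorem HasPresentation.exists_frame {A : SAA F L} {r : F} (h : A.HasPresentation r) :
    finrank F L = 10 ∧ ∃ x y, A.PresentedFrame r x y := by
  obtain ⟨b, hb⟩ := h
  exact ⟨finrank_of_basis b, _, _, hb.presentedFrame⟩

namespace PresentedFrame

variable {A : SAA F L} {r : F} {x y : Fin 5 → L}

/-- The products of the vectors of a presented frame. -/
theorem products (h : A.PresentedFrame r x y) (hn : finrank F L = 10) :
    A.mul (x 0) (y 1) = x 4 ∧ A.mul (x 0) (y 2) = x 3 ∧ A.mul (x 0) (y 3) = -x 2 ∧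
    A.mul (x 0) (y 4) = -x 1 ∧ A.mul (x 1) (y 2) = r • x 4 ∧ A.mul (x 1) (y 3) = 0 ∧
    A.mul (x 1) (y 4) = -(r • x 2) ∧ A.mul (x 2) (y 3) = x 4 ∧ A.mul (x 2) (y 4) = -x 3 ∧
    A.mul (x 3) (y 4) = 0 ∧ A.mul (y 0) (y 1) = x 2 ∧ A.mul (y 0) (y 2) = -x 1 ∧
    A.mul (y 0) (y 3) = 0 ∧ A.mul (y 0) (y 4) = 0 ∧ A.mul (y 1) (y 2) = x 0 ∧
    A.mul (y 1) (y 3) = 0 ∧ A.mul (y 1) (y 4) = -y 0 ∧ A.mul (y 2) (y 3) = -y 0 ∧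
    A.mul (y 2) (y 4) = -(r • y 1) ∧ A.mul (y 3) (y 4) = -y 2 := by
  have hr := h.rules
  have hx := h.xyy
  have hy := h.yyy
  have expand : ∀ u v, A.mul u v = ∑ i, A.triple u v (y i) • x i - ∑ i, A.triple u v (x i) • y i :=
    fun u v => h.expand hn _
  refine ⟨?_, ?_, ?_, ?_, ?_, ?_, ?_, ?_, ?_, ?_, ?_, ?_, ?_, ?_, ?_, ?_, ?_, ?_, ?_, ?_⟩
  all_goals
    rw [expand]
    simp [Fin.sum_univ_five, hr, hx, hy, presentationα, presentationβ]

theorem rest (h : A.PresentedFrame r x y) :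
    (∀ i j, A.mul (x i) (x j) = 0) ∧ (∀ i j, j ≤ i → A.mul (x i) (y j) = 0) ∧
    (∀ i j, A.mul (y i) (x j) = -A.mul (x j) (y i)) ∧ (∀ i, A.mul (y i) (y i) = 0) ∧
    (∀ i j, j < i → A.mul (y i) (y j) = -A.mul (y j) (y i)) :=
  ⟨h.mul_xx, h.mul_xy, fun _ _ => A.mul_neg_comm _ _, fun _ => A.mul_self _,
    fun _ _ _ => A.mul_neg_comm _ _⟩

end PresentedFrame

/-- Algebras with the same presentation are isomorphic. -/
theorem HasPresentation.isomorphic {L' : Type w} [AddCommGroup L'] [Module F L']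
    {A : SAA F L} {A' : SAA F L'} {r : F} (h : A.HasPresentation r) (h' : A'.HasPresentation r) :
    A.Isomorphic A' := by
  obtain ⟨b, hb⟩ := h
  obtain ⟨b', hb'⟩ := h'
  have hf := hb.presentedFrame
  have hf' := hb'.presentedFrame
  have hp := hf.products (finrank_of_basis b)
  have hp' := hf'.products (finrank_of_basis b')
  have hq := hf.rest
  have hq' := hf'.rest
  set φ := b.equiv b' (Equiv.refl _) with hφ
  have hφb : ∀ i, φ (b i) = b' i := fun i => by simp [hφ]
  refine ⟨φ, fun u v => ?_, fun u v => ?_⟩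
  · suffices A'.form.compl₁₂ φ.toLinearMap φ.toLinearMap = A.form from
      LinearMap.congr_fun₂ this u v
    refine b.ext fun i => b.ext fun j => ?_
    simp only [LinearMap.compl₁₂_apply, LinearEquiv.coe_coe, hφb]
    rcases i with i | i <;> rcases j with j | j
    · rw [hf.form_xx, hf'.form_xx]
    · rw [hf.form_xy, hf'.form_xy]
    · rw [hf.form_yx, hf'.form_yx]
    · rw [hf.form_yy, hf'.form_yy]
  · suffices A.mul.compr₂ φ.toLinearMap = A'.mul.compl₁₂ φ.toLinearMap φ.toLinearMap from
      LinearMap.congr_fun₂ this u v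
    refine b.ext fun i => b.ext fun j => ?_
    simp only [LinearMap.compl₁₂_apply, LinearMap.compr₂_apply, LinearEquiv.coe_coe, hφb]
    have hxy : ∀ i j, φ (A.mul (b (Sum.inl i)) (b (Sum.inr j))) =
        A'.mul (b' (Sum.inl i)) (b' (Sum.inr j)) := by
      intro i j
      fin_cases i <;> fin_cases j <;> simp [hp, hp', hq, hq', hφb]
    rcases i with i | i <;> rcases j with j | j
    · rw [hq.1, hq'.1, map_zero]
    · exact hxy i j
    · rw [hq.2.2.1, hq'.2.2.1, map_neg, hxy]
    · fin_cases i <;> fin_cases j <;> simp [hp, hp', hq, hq', hφb]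

theorem HasPresentation.scale {A : SAA F L} {r : F} (h : A.HasPresentation r) {a : F}
    (ha : a ≠ 0) : A.HasPresentation (r * a ^ 12) := by
  obtain ⟨hn, x, y, hf⟩ := h.exists_frame
  -- These exponents fix α125, α134, α345 and β123, while α235 is multiplied by a⁴ a³ a⁵ = a¹².
  have hd : ∀ i, (![a, (a ^ 4)⁻¹, a ^ 3, (a ^ 2)⁻¹, a ^ 5] : Fin 5 → F) i ≠ 0 := by
    intro i
    fin_cases i <;> simp [ha]
  refine (hf.toFrame.scale hd).hasPresentation hn (fun i j k hij hjk => ?_)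
    (fun i j k hij hjk => ?_)
  · simp only [triple_smul_left, triple_smul_mid, triple_smul_right, hf.xyy i j k hij hjk]
    simp only [presentationα]
    split_ifs with h1 h2 h3 h4
    · obtain ⟨rfl, rfl, rfl⟩ : i = 1 ∧ j = 2 ∧ k = 4 := by simpa using h1
      simp; field_simp
    · obtain ⟨rfl, rfl, rfl⟩ : i = 2 ∧ j = 3 ∧ k = 4 := by simpa using h2
      simp; field_simp
    · obtain ⟨rfl, rfl, rfl⟩ : i = 0 ∧ j = 1 ∧ k = 4 := by simpa using h3
      simp; field_simp
    · obtain ⟨rfl, rfl, rfl⟩ : i = 0 ∧ j = 2 ∧ k = 3 := by simpa using h4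
      simp; field_simp
    · simp
  · simp only [triple_smul_left, triple_smul_mid, triple_smul_right, hf.yyy i j k hij hjk]
    simp only [presentationβ]
    split_ifs with h1
    · obtain ⟨rfl, rfl, rfl⟩ : i = 0 ∧ j = 1 ∧ k = 2 := by simpa using h1
      simp; field_simp
    · simp

/-! ### The lower central series in terms of weights -/

section Series

/-- The weight of a frame vector: the largest `k ≤ 7` such that it lies in `L ^ k`. -/
def weight : Fin 5 ⊕ Fin 5 → ℕ := Sum.elim ![4, 5, 6, 7, 7] ![4, 3, 2, 1, 1]

variable {A : SAA F L} {r : F} {x y : Fin 5 → L}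

/-- The span of the frame vectors of weight at least `k`. -/
def weightSpan (F : Type u) {L : Type v} [Field F] [AddCommGroup L] [Module F L]
    (x y : Fin 5 → L) (k : ℕ) : Submodule F L :=
  Submodule.span F (Sum.elim x y '' {i | k ≤ weight i})

theorem x_mem_weightSpan {i : Fin 5} {k : ℕ} (h : k ≤ weight (Sum.inl i)) :
    x i ∈ weightSpan F x y k := Submodule.subset_span ⟨Sum.inl i, h, rfl⟩

theorem y_mem_weightSpan {i : Fin 5} {k : ℕ} (h : k ≤ weight (Sum.inr i)) :
    y i ∈ weightSpan F x y k := Submodule.subset_span ⟨Sum.inr i, h, rfl⟩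

/-- Multiplication raises the weight; by induction this bounds the lower central series from above.
-/
theorem PresentedFrame.mul_mem_weightSpan (h : A.PresentedFrame r x y) (hn : finrank F L = 10)
    (i j : Fin 5 ⊕ Fin 5) :
    A.mul (Sum.elim x y i) (Sum.elim x y j) ∈ weightSpan F x y (weight i + 1) := by
  have hp := h.products hn
  have hq := h.rest
  have hx : ∀ i k, k ≤ weight (Sum.inl i) → x i ∈ weightSpan F x y k := fun i k =>
    x_mem_weightSpan
  have hy : ∀ i k, k ≤ weight (Sum.inr i) → y i ∈ weightSpan F x y k := fun i k =>
    y_mem_weightSpan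
  rcases i with i | i <;> rcases j with j | j
  · simp [hq]
  all_goals
    fin_cases i <;> fin_cases j <;> simp [hp, hq] <;>
      first
      | exact hx _ _ (by decide)
      | exact hy _ _ (by decide)
      | exact Submodule.smul_mem _ _ (hx _ _ (by decide))
      | exact Submodule.smul_mem _ _ (hy _ _ (by decide))

theorem PresentedFrame.weightSpan_one (h : A.PresentedFrame r x y) (hn : finrank F L = 10) :
    weightSpan F x y 1 = ⊤ := by
  rw [eq_top_iff]
  intro v _
  rw [h.expand hn v]
  refine sub_mem (sum_mem fun i _ => Submodule.smul_mem _ _ (x_mem_weightSpan ?_))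
    (sum_mem fun i _ => Submodule.smul_mem _ _ (y_mem_weightSpan ?_)) <;>
  · revert i; decide

theorem PresentedFrame.lcs_le (h : A.PresentedFrame r x y) (hn : finrank F L = 10) :
    ∀ k, A.lcs (k + 1) ≤ weightSpan F x y (k + 1)
  | 0 => by rw [h.weightSpan_one hn]; exact le_top
  | k + 1 => by
    rw [lcs_succ_succ]
    refine (A.prod_mono (h.lcs_le hn k) (h.weightSpan_one hn).ge).trans ?_
    rw [prod, weightSpan, weightSpan, Submodule.map₂_span_span, Submodule.span_le]
    rintro _ ⟨_, ⟨i, hi, rfl⟩, _, ⟨j, -, rfl⟩, rfl⟩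
    refine Submodule.span_mono (Set.image_mono fun l hl => ?_) (h.mul_mem_weightSpan hn i j)
    exact (Nat.succ_le_succ hi).trans hl

theorem PresentedFrame.lcs_eight (h : A.PresentedFrame r x y) (hn : finrank F L = 10) :
    A.lcs 8 = ⊥ := by
  rw [eq_bot_iff]
  refine (h.lcs_le hn 7).trans ?_
  rw [weightSpan, Submodule.span_le]
  rintro _ ⟨i, hi, rfl⟩
  exfalso
  revert i
  decide

/-- The bound from below: up to nonzero scalars, y₃, y₂, y₁, x₁, x₂, x₃, x₄, x₅ arise in turn as
y₄y₅, y₃y₅, y₂y₅, y₂y₃, y₁y₃, x₂y₅, x₃y₅, x₃y₄. The scalars of y₂ and x₃ contain r, hence r ≠ 0. -/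
theorem PresentedFrame.mem_lcs (h : A.PresentedFrame r x y) (hn : finrank F L = 10)
    (hr : r ≠ 0) : (y 2 ∈ A.lcs 2) ∧ (y 1 ∈ A.lcs 3) ∧ (y 0 ∈ A.lcs 4) ∧ (x 0 ∈ A.lcs 4) ∧
      (x 1 ∈ A.lcs 5) ∧ (x 2 ∈ A.lcs 6) ∧ (x 3 ∈ A.lcs 7) ∧ (x 4 ∈ A.lcs 7) := by
  obtain ⟨-, -, -, -, -, -, h15, h24, h25, -, -, h13', -, -, h23', -, h25', -, h35', h45'⟩ :=
    h.products hn
  have y2 : y 2 ∈ A.lcs 2 := by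
    simpa [h45'] using A.mul_mem_lcs (k := 0) (Submodule.mem_top (x := y 3)) (y 4)
  have y1 : y 1 ∈ A.lcs 3 := by
    have := A.mul_mem_lcs y2 (y 4)
    rwa [h35', neg_mem_iff, Submodule.smul_mem_iff _ hr] at this
  have y0 : y 0 ∈ A.lcs 4 := by simpa [h25'] using A.mul_mem_lcs y1 (y 4)
  have x0 : x 0 ∈ A.lcs 4 := by simpa [h23'] using A.mul_mem_lcs y1 (y 2)
  have x1 : x 1 ∈ A.lcs 5 := by simpa [h13'] using A.mul_mem_lcs y0 (y 2)
  have x2 : x 2 ∈ A.lcs 6 := by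
    have := A.mul_mem_lcs x1 (y 4)
    rwa [h15, neg_mem_iff, Submodule.smul_mem_iff _ hr] at this
  have x3 : x 3 ∈ A.lcs 7 := by simpa [h25] using A.mul_mem_lcs x2 (y 4)
  have x4 : x 4 ∈ A.lcs 7 := by simpa [h24] using A.mul_mem_lcs x2 (y 3)
  exact ⟨y2, y1, y0, x0, x1, x2, x3, x4⟩

theorem PresentedFrame.lcs_eq (h : A.PresentedFrame r x y) (hn : finrank F L = 10)
    (hr : r ≠ 0) {k : ℕ} : A.lcs (k + 1) = weightSpan F x y (k + 1) := by
  refine le_antisymm (h.lcs_le hn k) ?_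
  rw [weightSpan, Submodule.span_le]
  obtain ⟨y2, y1, y0, x0, x1, x2, x3, x4⟩ := h.mem_lcs hn hr
  have key : ∀ i, Sum.elim x y i ∈ A.lcs (weight i) := by
    rintro (i | i) <;> fin_cases i <;> first | assumption | exact Submodule.mem_top
  rintro _ ⟨i, hi, rfl⟩
  exact A.lcs_antitone hi (key i)

theorem PresentedFrame.finrank_lcs_eq (h : A.PresentedFrame r x y) (hn : finrank F L = 10)
    (hr : r ≠ 0) {k : ℕ} :
    finrank F (A.lcs (k + 1)) = Fintype.card {i // k + 1 ≤ weight i} := by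
  have hli := (A.linearIndependent_of_standard h.form_xx h.form_yy h.form_xy).comp
    (Subtype.val : {i // k + 1 ≤ weight i} → _) Subtype.val_injective
  rw [h.lcs_eq hn hr, ← finrank_span_eq_card hli, Set.range_comp,
    Subtype.range_val_subtype]
  rfl

end Series

end Presented


/-! ### Presented algebras have the stated properties -/

section Converse

variable {F : Type u} {L : Type v} [Field F] [AddCommGroup L] [Module F L]
variable {A : SAA F L} {r : F} {x y : Fin 5 → L}

theorem PresentedFrame.prod_five_two_le (h : A.PresentedFrame r x y) (hn : finrank F L = 10)
    (hr : r ≠ 0) : A.prod (A.lcs 5) (A.lcs 2) ≤ Submodule.span F {x 4} := by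
  have hp := h.products hn
  have hq := h.rest
  have hx := Submodule.mem_span_singleton_self (R := F) (x 4)
  rw [h.lcs_eq hn hr, h.lcs_eq hn hr, prod, weightSpan, weightSpan, Submodule.map₂_span_span,
    Submodule.span_le]
  rintro _ ⟨_, ⟨i, hi, rfl⟩, _, ⟨j, hj, rfl⟩, rfl⟩
  rcases i with i | i
  · rcases j with j | j
    · simp [hq]
    · fin_cases i <;> first | (exfalso; revert hi; decide) | skip
      all_goals fin_cases j <;> first | (exfalso; revert hj; decide) | skip
      all_goals simp [hp, hq, Submodule.smul_mem _ _ hx]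
  · exfalso
    revert i
    decide

theorem PresentedFrame.lcs_seven (h : A.PresentedFrame r x y) (hn : finrank F L = 10)
    (hr : r ≠ 0) : A.lcs 7 = Submodule.span F {x 3, x 4} := by
  rw [h.lcs_eq hn hr, weightSpan]
  congr 1
  have : {i | 6 + 1 ≤ weight i} = {Sum.inl 3, Sum.inl 4} := by
    ext i
    revert i
    decide
  rw [this, Set.image_insert_eq, Set.image_singleton]
  rfl

/-- x₁ lies in U, and x₁y₃ = x₄, x₁y₂ = x₅ span L⁷. Conversely y₁y₂ = x₃ ∉ L⁵L² keeps y₁ out of U,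
so U lies in the span of the x_i, whose products with L² fall into L⁷. -/
theorem PresentedFrame.subspaceU_mul (h : A.PresentedFrame r x y) (hn : finrank F L = 10)
    (hr : r ≠ 0) (hI : A.indexI = 1) : A.prod A.subspaceU (A.lcs 2) = A.lcs 7 := by
  have hp := h.products hn
  have hq := h.rest
  obtain ⟨y2, y1, y0, x0, x1, x2, x3, x4⟩ := h.mem_lcs hn hr
  have h8 := h.lcs_eight hn
  have h52 := h.prod_five_two_le hn hr
  have hI1 : A.idealI A.indexI = A.prod (A.lcs 5) (A.lcs 2) := by rw [hI]; rfl
  have e4 : x 4 ∈ A.prod (A.lcs 5) (A.lcs 2) := by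
    have := A.mem_prod x1 y2
    rwa [hp.2.2.2.2.1, Submodule.smul_mem_iff _ hr] at this
  have x0U : x 0 ∈ A.subspaceU := by
    refine ⟨x0, ?_⟩
    have : A.prod (Submodule.span F {x 0}) (A.lcs 3) ≤ A.idealI A.indexI := by
      rw [hI1, h.lcs_eq hn hr, prod, weightSpan, Submodule.map₂_span_span, Submodule.span_le]
      rintro _ ⟨_, rfl, _, ⟨j, hj, rfl⟩, rfl⟩
      rcases j with j | j
      · simp [hq]
      · fin_cases j <;> first | (exfalso; revert hj; decide) | skip
        all_goals simp [hp, hq, e4]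
    exact fun v hv => this (A.mem_prod (Submodule.mem_span_singleton_self _) hv)
  apply le_antisymm
  · have hU : A.subspaceU ≤ Submodule.span F (Set.range x) := by
      rintro u ⟨hu, huU⟩
      have hu5 := A.mem_perp.1 (A.lcs_le_perp (i := 3) (j := 4) h8 hu)
      have x2' : x 2 ∈ A.lcs 5 := A.lcs_succ_le 5 x2
      have x3' : x 3 ∈ A.lcs 5 := A.lcs_antitone (by norm_num : 5 ≤ 7) x3
      have x4' : x 4 ∈ A.lcs 5 := A.lcs_antitone (by norm_num : 5 ≤ 7) x4
      have hexp := h.expand hn u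
      simp only [Fin.sum_univ_five _, hu5 _ x1, hu5 _ x2', hu5 _ x3', hu5 _ x4', zero_smul,
        add_zero] at hexp
      have h0 : A.form u (x 0) = 0 := by
        have hm := huU _ y1
        rw [hI1] at hm
        obtain ⟨k, hk⟩ := Submodule.mem_span_singleton.1 (h52 hm)
        have := congrArg (fun v => A.form v (y 2)) hk
        rw [hexp] at this
        simpa [hp, hq, h.form_xy, h.form_yy] using this.symm
      rw [hexp, h0, zero_smul, sub_zero]
      have hs : ∀ i, x i ∈ Submodule.span F (Set.range x) := fun i =>
        Submodule.subset_span ⟨i, rfl⟩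
      exact add_mem (add_mem (add_mem (add_mem (Submodule.smul_mem _ _ (hs 0))
        (Submodule.smul_mem _ _ (hs 1))) (Submodule.smul_mem _ _ (hs 2)))
        (Submodule.smul_mem _ _ (hs 3))) (Submodule.smul_mem _ _ (hs 4))
    refine (A.prod_mono hU le_rfl).trans ?_
    rw [h.lcs_eq hn hr, prod, weightSpan, Submodule.map₂_span_span, Submodule.span_le]
    rintro _ ⟨_, ⟨i, rfl⟩, _, ⟨j, hj, rfl⟩, rfl⟩
    rcases j with j | j
    · simp [hq]
    · fin_cases j <;> first | (exfalso; revert hj; decide) | skip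
      all_goals fin_cases i <;> simp [hp, hq, x3, x4, Submodule.smul_mem _ _ x4]
  · rw [h.lcs_seven hn hr, Submodule.span_le, Set.insert_subset_iff, Set.singleton_subset_iff]
    constructor
    · rw [← hp.2.1]; exact A.mem_prod x0U y2
    · rw [← hp.1]; exact A.mem_prod x0U (A.lcs_succ_le 2 y1)

theorem PresentedFrame.hasProperties (h : A.PresentedFrame r x y) (hn : finrank F L = 10)
    (hr : r ≠ 0) : A.HasProperties := by
  have : FiniteDimensional F L := FiniteDimensional.of_finrank_pos (by omega)
  have hp := h.products hn
  obtain ⟨y2, y1, y0, x0, x1, x2, x3, x4⟩ := h.mem_lcs hn hr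
  have h8 := h.lcs_eight hn
  have d7 : finrank F (A.lcs 7) = 2 := h.finrank_lcs_eq hn hr
  have d2 : finrank F (A.lcs 2) = 8 := h.finrank_lcs_eq hn hr
  have dZ : finrank F A.center = 2 := by rw [A.center_eq_perp, A.finrank_perp, hn, d2]
  have hZ : A.lcs 7 = A.center := Submodule.eq_of_le_of_finrank_le
    (A.center_eq_perp ▸ A.lcs_le_perp (i := 6) (j := 1) h8) (by rw [dZ, d7])
  have hxy : ∀ i, x i ≠ 0 := fun i h0 => by
    have := h.form_xy i i
    simp [h0] at this
  have hle : A.prod (A.lcs 5) (A.lcs 2) ≤ A.prod (A.lcs 4) (A.lcs 3) := by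
    refine (h.prod_five_two_le hn hr).trans ?_
    rw [Submodule.span_singleton_le_iff_mem, ← hp.1]
    exact A.mem_prod x0 y1
  have hI : A.indexI = 1 := by
    apply A.indexI_eq_one hle
    intro h0
    have := A.mem_prod x1 y2
    rw [h0, Submodule.mem_bot, hp.2.2.2.2.1] at this
    exact (smul_ne_zero hr (hxy 4)) this
  refine ⟨hn, ⟨7, h8⟩, ?_, dZ, ⟨h8, fun m hm => ?_⟩, fun he => ?_, hle, ?_⟩
  · intro u hu v hv
    rw [A.center_eq_perp] at hu
    rw [← hZ] at hv
    exact A.mem_perp.1 hu v (A.lcs_antitone (by norm_num : 2 ≤ 7) hv)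
  · by_contra! hlt
    have := A.lcs_antitone (show m + 1 ≤ 7 by omega) x3
    rw [show A.lcs (m + 1) = ⊥ from hm, Submodule.mem_bot] at this
    exact hxy 3 this
  -- y₁y₂ = x₃ belongs to L⁴L³ but not to L⁷, since it is not orthogonal to y₃ ∈ L².
  · have := A.mem_prod y0 y1
    rw [he, hp.2.2.2.2.2.2.2.2.2.2.1] at this
    have := A.mem_perp.1 (A.lcs_le_perp (i := 6) (j := 1) h8 this) _ y2
    simp [h.form_xy] at this
  · rw [h.subspaceU_mul hn hr hI, d7]

end Converse


/-! ### Invariance of the parameter up to twelfth powers -/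

section Invariant

variable {F : Type u} {L : Type v} [Field F] [AddCommGroup L] [Module F L]

theorem Frame.expand' {A : SAA F L} {x y : Fin 5 → L} (h : A.Frame x y) (hn : finrank F L = 10)
    (v : L) : v = ∑ i, A.form v (y i) • x i + ∑ i, (-A.form v (x i)) • y i := by
  conv_lhs => rw [h.expand hn v]
  simp [sub_eq_add_neg]

/-- The parameters of two presentations of the same algebra differ by a twelfth power. -/
theorem PresentedFrame.div_eq_pow {A : SAA F L} {r s : F} {x y x' y' : Fin 5 → L}
    (h : A.PresentedFrame r x y) (h' : A.PresentedFrame s x' y') (hn : finrank F L = 10)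
    (hr : r ≠ 0) (hs : s ≠ 0) : ∃ a : F, a ≠ 0 ∧ s / r = a ^ 12 := by
  have hp := h.products hn
  have hq := h.rest
  obtain ⟨p01, p02, -, -, p12, -, -, p23, -, -, q01, -, -, -, -, -, -, -, -, -⟩ := h'.products hn
  have h8 := h.lcs_eight hn
  obtain ⟨y2, y1, y0, x0, x1, x2, x3, x4⟩ := h.mem_lcs hn hr
  obtain ⟨y2', y1', y0', x0', x1', x2', x3', x4'⟩ := h'.mem_lcs hn hs
  have hlcs := @lcs_antitone F L _ _ _ A
  have x0_3 := hlcs (show 3 ≤ 4 by norm_num) x0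
  have y0_3 := hlcs (show 3 ≤ 4 by norm_num) y0
  have y0_2 := hlcs (show 2 ≤ 3 by norm_num) y0_3
  have y1_2 := hlcs (show 2 ≤ 3 by norm_num) y1
  have x0_2 := hlcs (show 2 ≤ 3 by norm_num) x0_3
  have x1_4 := hlcs (show 4 ≤ 5 by norm_num) x1
  have x1_3 := hlcs (show 3 ≤ 4 by norm_num) x1_4
  have x1_2 := hlcs (show 2 ≤ 3 by norm_num) x1_3
  have x2_5 := hlcs (show 5 ≤ 6 by norm_num) x2
  have x2_4 := hlcs (show 4 ≤ 5 by norm_num) x2_5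
  have x2_3 := hlcs (show 3 ≤ 4 by norm_num) x2_4
  have x2_2 := hlcs (show 2 ≤ 3 by norm_num) x2_3
  have x3_6 := hlcs (show 6 ≤ 7 by norm_num) x3
  have x4_6 := hlcs (show 6 ≤ 7 by norm_num) x4
  have x3_5 := hlcs (show 5 ≤ 6 by norm_num) x3_6
  have x4_5 := hlcs (show 5 ≤ 6 by norm_num) x4_6
  have x3_4 := hlcs (show 4 ≤ 5 by norm_num) x3_5
  have x4_4 := hlcs (show 4 ≤ 5 by norm_num) x4_5
  have x3_3 := hlcs (show 3 ≤ 4 by norm_num) x3_4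
  have x4_3 := hlcs (show 3 ≤ 4 by norm_num) x4_4
  have x3_2 := hlcs (show 2 ≤ 3 by norm_num) x3_3
  have x4_2 := hlcs (show 2 ≤ 3 by norm_num) x4_3
  have o2 : ∀ {u v : L}, u ∈ A.lcs 2 → v ∈ A.lcs 7 → A.form u v = 0 := fun hu hv =>
    A.mem_perp.1 (A.lcs_le_perp (i := 1) (j := 6) h8 hu) _ hv
  have o3 : ∀ {u v : L}, u ∈ A.lcs 3 → v ∈ A.lcs 6 → A.form u v = 0 := fun hu hv =>
    A.mem_perp.1 (A.lcs_le_perp (i := 2) (j := 5) h8 hu) _ hv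
  have o4 : ∀ {u v : L}, u ∈ A.lcs 4 → v ∈ A.lcs 5 → A.form u v = 0 := fun hu hv =>
    A.mem_perp.1 (A.lcs_le_perp (i := 3) (j := 4) h8 hu) _ hv
  have o5 : ∀ {u v : L}, u ∈ A.lcs 5 → v ∈ A.lcs 4 → A.form u v = 0 := fun hu hv =>
    A.mem_perp.1 (A.lcs_le_perp (i := 4) (j := 3) h8 hu) _ hv
  have o6 : ∀ {u v : L}, u ∈ A.lcs 6 → v ∈ A.lcs 3 → A.form u v = 0 := fun hu hv =>
    A.mem_perp.1 (A.lcs_le_perp (i := 5) (j := 2) h8 hu) _ hv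
  have o7 : ∀ {u v : L}, u ∈ A.lcs 7 → v ∈ A.lcs 2 → A.form u v = 0 := fun hu hv =>
    A.mem_perp.1 (A.lcs_le_perp (i := 6) (j := 1) h8 hu) _ hv
  -- The orthogonality relations L^i ⊥ L^(9-i) make the change of basis block triangular. Diagonal
  -- entries are named e_i (for x) and d_i (for y). Among the other entries only f, g and e43, which
  -- mix vectors of equal weight, interfere with the comparison.
  obtain ⟨e0, e01, e02, e03, e04, f, hx0⟩ : ∃ c0 c1 c2 c3 c4 f : F, x' 0 =
      c0 • x 0 + c1 • x 1 + c2 • x 2 + c3 • x 3 + c4 • x 4 + f • y 0 := by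
    have e := h.expand' hn (x' 0)
    simp only [Fin.sum_univ_five, o4 x0' x1, o4 x0' x2_5, o4 x0' x3_5, o4 x0' x4_5, neg_zero,
      zero_smul, add_zero] at e
    exact ⟨_, _, _, _, _, _, e⟩
  obtain ⟨e1, e12, e13, e14, hx1⟩ : ∃ c1 c2 c3 c4 : F, x' 1 =
      c1 • x 1 + c2 • x 2 + c3 • x 3 + c4 • x 4 := by
    have e := h.expand' hn (x' 1)
    simp only [Fin.sum_univ_five, o5 x1' x0, o5 x1' x1_4, o5 x1' x2_4, o5 x1' x3_4, o5 x1' x4_4,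
      o5 x1' y0, neg_zero, zero_smul, add_zero, zero_add] at e
    exact ⟨_, _, _, _, e⟩
  obtain ⟨e2, e23, e24, hx2⟩ : ∃ c2 c3 c4 : F, x' 2 = c2 • x 2 + c3 • x 3 + c4 • x 4 := by
    have e := h.expand' hn (x' 2)
    simp only [Fin.sum_univ_five, o6 x2' x0_3, o6 x2' x1_3, o6 x2' x2_3, o6 x2' x3_3, o6 x2' x4_3,
      o6 x2' y0_3, o6 x2' y1, neg_zero, zero_smul, add_zero, zero_add] at e
    exact ⟨_, _, _, e⟩
  obtain ⟨e3, e34, hx3⟩ : ∃ c3 c4 : F, x' 3 = c3 • x 3 + c4 • x 4 := by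
    have e := h.expand' hn (x' 3)
    simp only [Fin.sum_univ_five, o7 x3' x0_2, o7 x3' x1_2, o7 x3' x2_2, o7 x3' x3_2, o7 x3' x4_2,
      o7 x3' y0_2, o7 x3' y1_2, o7 x3' y2, neg_zero, zero_smul, add_zero, zero_add] at e
    exact ⟨_, _, e⟩
  obtain ⟨e43, e4, hx4⟩ : ∃ c3 c4 : F, x' 4 = c3 • x 3 + c4 • x 4 := by
    have e := h.expand' hn (x' 4)
    simp only [Fin.sum_univ_five, o7 x4' x0_2, o7 x4' x1_2, o7 x4' x2_2, o7 x4' x3_2, o7 x4' x4_2,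
      o7 x4' y0_2, o7 x4' y1_2, o7 x4' y2, neg_zero, zero_smul, add_zero, zero_add] at e
    exact ⟨_, _, e⟩
  obtain ⟨a00, a01, a02, a03, a04, d0, hy0⟩ : ∃ c0 c1 c2 c3 c4 d0 : F, y' 0 =
      c0 • x 0 + c1 • x 1 + c2 • x 2 + c3 • x 3 + c4 • x 4 + d0 • y 0 := by
    have e := h.expand' hn (y' 0)
    simp only [Fin.sum_univ_five, o4 y0' x1, o4 y0' x2_5, o4 y0' x3_5, o4 y0' x4_5, neg_zero,
      zero_smul, add_zero] at e
    exact ⟨_, _, _, _, _, _, e⟩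
  obtain ⟨a10, a11, a12, a13, a14, b10, d1, hy1⟩ : ∃ c0 c1 c2 c3 c4 b0 b1 : F, y' 1 =
      c0 • x 0 + c1 • x 1 + c2 • x 2 + c3 • x 3 + c4 • x 4 + (b0 • y 0 + b1 • y 1) := by
    have e := h.expand' hn (y' 1)
    simp only [Fin.sum_univ_five, o3 y1' x2, o3 y1' x3_6, o3 y1' x4_6, neg_zero,
      zero_smul, add_zero] at e
    exact ⟨_, _, _, _, _, _, _, e⟩
  obtain ⟨a20, a21, a22, a23, a24, b20, b21, d2, hy2⟩ : ∃ c0 c1 c2 c3 c4 b0 b1 b2 : F, y' 2 =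
      c0 • x 0 + c1 • x 1 + c2 • x 2 + c3 • x 3 + c4 • x 4 + (b0 • y 0 + b1 • y 1 + b2 • y 2) := by
    have e := h.expand' hn (y' 2)
    simp only [Fin.sum_univ_five, o2 y2' x3, o2 y2' x4, neg_zero, zero_smul, add_zero] at e
    exact ⟨_, _, _, _, _, _, _, _, e⟩
  obtain ⟨a30, a31, a32, a33, a34, b30, b31, b32, d3, g, hy3⟩ :
      ∃ c0 c1 c2 c3 c4 b0 b1 b2 b3 b4 : F, y' 3 =
      c0 • x 0 + c1 • x 1 + c2 • x 2 + c3 • x 3 + c4 • x 4 +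
      (b0 • y 0 + b1 • y 1 + b2 • y 2 + b3 • y 3 + b4 • y 4) := by
    have e := h.expand' hn (y' 3)
    simp only [Fin.sum_univ_five] at e
    exact ⟨_, _, _, _, _, _, _, _, _, _, e⟩
  have u0 := h'.form_xy 0 0
  have u1 := h'.form_xy 1 1
  have u2 := h'.form_xy 2 2
  have u3 := h'.form_xy 3 3
  have i1 := congrArg (A.form · (y 4)) p12
  have i2 := congrArg (A.form · (y 3)) p12
  have i3 := congrArg (A.form · (y 3)) p23
  have i4 := congrArg (A.form · (y 4)) p23
  have i5 := congrArg (A.form · (y 2)) p01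
  have i6 := congrArg (A.form · (y 4)) p01
  have i7 := congrArg (A.form · (y 3)) p02
  have i8 := congrArg (A.form · (y 2)) q01
  simp only [hx0, hx1, hx2, hx3, hx4, hy0, hy1, hy2, hy3] at u0 u1 u2 u3 i1 i2 i3 i4 i5 i6 i7 i8
  simp [hp, hq, h.form_xx, h.form_yy, h.form_xy, h.form_yx] at u0 u1 u2 u3 i1 i2 i3 i4 i5 i6 i7 i8
  have e2_ne : e2 ≠ 0 := left_ne_zero_of_mul_eq_one u2
  have d1_ne : d1 ≠ 0 := right_ne_zero_of_mul_eq_one u1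
  have d2_ne : d2 ≠ 0 := right_ne_zero_of_mul_eq_one u2
  -- x′₂y′₃ ∈ L⁵L² = ⟨x₅⟩ removes e43; then x′₃y′₄ = x′₅ gives g = 0. Next, f = 0 because x′₁y′₂ =
  -- x′₅ has no x₃-component. Now e_i d_i = 1 for the first four indices.
  have g0 : g = 0 := by simpa [i2.resolve_left hs, e2_ne] using i3
  rw [i5.resolve_right d1_ne, zero_mul, neg_zero, add_zero] at u0
  rw [g0, mul_zero, add_zero] at u3
  have d3_ne : d3 ≠ 0 := right_ne_zero_of_mul_eq_one u3
  have e4_ne : e4 ≠ 0 := i4 ▸ mul_ne_zero e2_ne d3_ne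
  have hd0 : d0 = d2 * d3 := by linear_combination d2 * d3 * u0 - d0 * u3 - d0 * d3 * i7
  have hd1 : d1 = d3 ^ 2 := by
    have : e2 * d1 = e2 * d3 ^ 2 := by
      linear_combination (-e2 * d1) * u0 + e2 * d0 * i6 - e2 * d0 * i4 + e2 ^ 2 * d3 * hd0 +
        e2 * d3 ^ 2 * u2
    exact mul_left_cancel₀ e2_ne this
  have hd : d2 ^ 2 * d3 ^ 3 = 1 := by
    rw [hd0, hd1] at i8
    linear_combination d2 * i8 + u2
  have he1 : e1 = 1 / d3 ^ 2 := by rw [← hd1]; field_simp; exact u1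
  have he4 : e4 = d3 / d2 := by rw [← i4]; field_simp; linear_combination u2
  -- On the torus d2 = a³ and d3 = a⁻², so a = 1 / (d2 d3²).
  refine ⟨1 / (d3 ^ 2 * d2), by simp [d2_ne, d3_ne], ?_⟩
  have hsr : s / r = e1 * d2 / e4 := by
    field_simp
    linear_combination -i1
  rw [hsr, he1, he4]
  field_simp
  -- With X = d2² d3³ the claim is X⁷ = 1, and the cofactor is (X⁷ - 1) / (X - 1).
  linear_combination (d2 ^ 12 * d3 ^ 18 + d2 ^ 10 * d3 ^ 15 + d2 ^ 8 * d3 ^ 12 + d2 ^ 6 * d3 ^ 9 +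
    d2 ^ 4 * d3 ^ 6 + d2 ^ 2 * d3 ^ 3 + 1) * hd

end Invariant

/-! ### An explicit algebra for every parameter -/

section Model

variable {F : Type u} [Field F]

/-- The standard symplectic form on `F ^ 10`. -/
def modelForm (F : Type u) [Field F] : (Fin 5 ⊕ Fin 5 → F) →ₗ[F] (Fin 5 ⊕ Fin 5 → F) →ₗ[F] F :=
  LinearMap.mk₂ F (fun u v => ∑ i, (u (Sum.inl i) * v (Sum.inr i) - u (Sum.inr i) * v (Sum.inl i)))
    (fun u u' v => by
      rw [← Finset.sum_add_distrib]; exact Finset.sum_congr rfl fun i _ => by simp; ring)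
    (fun c u v => by
      rw [smul_eq_mul, Finset.mul_sum]; exact Finset.sum_congr rfl fun i _ => by simp; ring)
    (fun u v v' => by
      rw [← Finset.sum_add_distrib]; exact Finset.sum_congr rfl fun i _ => by simp; ring)
    (fun c u v => by
      rw [smul_eq_mul, Finset.mul_sum]; exact Finset.sum_congr rfl fun i _ => by simp; ring)

theorem modelForm_apply (u v : Fin 5 ⊕ Fin 5 → F) : modelForm F u v =
    ∑ i, (u (Sum.inl i) * v (Sum.inr i) - u (Sum.inr i) * v (Sum.inl i)) := rfl

/-- The Plücker coordinates of two vectors. -/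
def minor (u v : Fin 5 ⊕ Fin 5 → F) (i j : Fin 5 ⊕ Fin 5) : F := u i * v j - u j * v i

theorem minor_self (u : Fin 5 ⊕ Fin 5 → F) (i j : Fin 5 ⊕ Fin 5) : minor u u i j = 0 := by
  rw [minor]; ring

theorem minor_single (k l i j : Fin 5 ⊕ Fin 5) :
    minor (Pi.single k (1 : F)) (Pi.single l 1) i j =
      (if i = k then if j = l then 1 else 0 else 0) -
        if j = k then if i = l then 1 else 0 else 0 := by
  simp only [minor, Pi.single_apply, ite_mul, one_mul, zero_mul]

open Sum in
/-- The product with presentation parameter `r` on `F ^ 10`. -/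
def modelMul (r : F) :
    (Fin 5 ⊕ Fin 5 → F) →ₗ[F] (Fin 5 ⊕ Fin 5 → F) →ₗ[F] (Fin 5 ⊕ Fin 5 → F) :=
  -- The coefficients are those of the table in `PresentedFrame.products`; using minors makes the
  -- product alternating by construction.
  LinearMap.mk₂ F (fun u v => Sum.elim
    ![minor u v (inr 1) (inr 2),
      -minor u v (inr 0) (inr 2) - minor u v (inl 0) (inr 4),
      minor u v (inr 0) (inr 1) - r * minor u v (inl 1) (inr 4) - minor u v (inl 0) (inr 3),
      minor u v (inl 0) (inr 2) - minor u v (inl 2) (inr 4),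
      minor u v (inl 0) (inr 1) + r * minor u v (inl 1) (inr 2) + minor u v (inl 2) (inr 3)]
    ![-minor u v (inr 1) (inr 4) - minor u v (inr 2) (inr 3),
      -(r * minor u v (inr 2) (inr 4)), -minor u v (inr 3) (inr 4), 0, 0])
    (fun u u' v => by ext i; rcases i with i | i <;> fin_cases i <;> simp [minor] <;> ring)
    (fun c u v => by ext i; rcases i with i | i <;> fin_cases i <;> simp [minor] <;> ring)
    (fun u v v' => by ext i; rcases i with i | i <;> fin_cases i <;> simp [minor] <;> ring)
    (fun c u v => by ext i; rcases i with i | i <;> fin_cases i <;> simp [minor] <;> ring)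

theorem modelForm_self (u : Fin 5 ⊕ Fin 5 → F) : modelForm F u u = 0 := by
  rw [modelForm_apply]
  exact Finset.sum_eq_zero fun i _ => by ring

theorem modelForm_separatingLeft {u : Fin 5 ⊕ Fin 5 → F} (h : ∀ v, modelForm F u v = 0) :
    u = 0 := by
  ext i
  rcases i with i | i
  · simpa [modelForm_apply, Pi.single_apply] using h (Pi.single (Sum.inr i) 1)
  · simpa [modelForm_apply, Pi.single_apply] using h (Pi.single (Sum.inl i) 1)

/-- The algebra on `F ^ 10` with the presentation of parameter `r`. -/
def model (r : F) : SAA F (Fin 5 ⊕ Fin 5 → F) where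
  form := modelForm F
  mul := modelMul r
  form_self := modelForm_self
  form_nondegenerate := by
    refine ⟨fun u h => modelForm_separatingLeft h, fun v h => modelForm_separatingLeft fun u => ?_⟩
    have := modelForm_self (u + v)
    simp only [map_add, LinearMap.add_apply, modelForm_self, h u] at this
    simpa using this
  mul_self u := by
    ext i
    rcases i with i | i <;> fin_cases i <;> simp [modelMul, minor_self]
  form_mul u v w := by
    simp only [modelForm_apply, modelMul, minor, LinearMap.mk₂_apply, Fin.sum_univ_five,
      Sum.elim_inl, Sum.elim_inr, Matrix.cons_val]
    ring

theorem model_form_y (r : F) (u : Fin 5 ⊕ Fin 5 → F) (k : Fin 5) :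
    (model r).form u (Pi.single (Sum.inr k) 1) = u (Sum.inl k) := by
  simp [model, modelForm_apply, Pi.single_apply]

theorem model_mul_x_y (r : F) (i j : Fin 5) (hij : j ≤ i) :
    (model r).mul (Pi.single (Sum.inl i) 1) (Pi.single (Sum.inr j) 1) = 0 := by
  change Sum.elim _ _ = 0
  simp only [minor_single]
  fin_cases i <;> fin_cases j <;> first | (exfalso; revert hij; decide) | skip
  all_goals
    simp
    ext k
    rcases k with k | k <;> fin_cases k <;> rfl

theorem model_hasPresentation (r : F) : (model r).HasPresentation r := by
  refine ⟨Pi.basisFun F (Fin 5 ⊕ Fin 5), ⟨?_, ?_, ?_⟩, ?_, ?_, ?_, ?_⟩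
  · intro i j
    simp [model, modelForm_apply]
  · intro i j
    simp [model, modelForm_apply]
  · intro i j
    simp [model, modelForm_apply, Pi.single_apply, eq_comm]
  · intro i j
    ext k
    rcases k with k | k <;> fin_cases k <;> simp [model, modelMul, minor]
  · intro i j hij
    simpa using model_mul_x_y r i j hij
  · intro i j k hij hjk
    rw [Pi.basisFun_apply, Pi.basisFun_apply, Pi.basisFun_apply, model_form_y]
    simp only [model, modelMul, LinearMap.mk₂_apply, minor_single, Sum.elim_inl]
    fin_cases i <;> fin_cases j <;> first | (exfalso; revert hij; decide) | skip
    all_goals fin_cases k <;> first | (exfalso; revert hjk; decide) | skip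
    all_goals simp [presentationα]
  · intro i j k hij hjk
    rw [Pi.basisFun_apply, Pi.basisFun_apply, Pi.basisFun_apply, model_form_y]
    simp only [model, modelMul, LinearMap.mk₂_apply, minor_single, Sum.elim_inl]
    fin_cases i <;> fin_cases j <;> first | (exfalso; revert hij; decide) | skip
    all_goals fin_cases k <;> first | (exfalso; revert hjk; decide) | skip
    all_goals simp [presentationβ]

end Model

/-- Pulling the basis back along the isomorphism places both presentations on one algebra, where
`PresentedFrame.div_eq_pow` compares them. -/
theorem HasPresentation.of_isomorphic {F : Type u} {L : Type v} {L' : Type w} [Field F]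
    [AddCommGroup L] [Module F L] [AddCommGroup L'] [Module F L'] {A : SAA F L} {A' : SAA F L'}
    {s : F} (hA : A.Isomorphic A') (h : A'.HasPresentation s) : A.HasPresentation s := by
  obtain ⟨φ, hform, hmul⟩ := hA
  obtain ⟨b, hb⟩ := h
  have hf : ∀ u v, A.form (φ.symm u) (φ.symm v) = A'.form u v := fun u v => by
    simp [← hform]
  have hm : ∀ u v, A.mul (φ.symm u) (φ.symm v) = φ.symm (A'.mul u v) := fun u v => by
    simp [LinearEquiv.eq_symm_apply, hmul]
  refine ⟨b.map φ.symm, ⟨?_, ?_, ?_⟩, ?_, ?_, ?_, ?_⟩ <;>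
    simp only [Basis.map_apply, hm, hf, EmbeddingLike.map_eq_zero_iff]
  · exact hb.standard.form_x_x
  · exact hb.standard.form_y_y
  · exact hb.standard.form_x_y
  · exact hb.x_mul_x
  · exact hb.x_mul_y
  · exact hb.xyy
  · exact hb.yyy

end SAA

theorem proposition3p6 (F : Type u) [Field F] :
    -- every algebra with the stated properties has such a presentation
    (∀ (L : Type v) [AddCommGroup L] [Module F L] (A : SAA F L),
      A.HasProperties → ∃ r : F, r ≠ 0 ∧ A.HasPresentation r) ∧
    -- two presentations describe the same algebra iff `s / r` is a twelfth power
    (∀ (L : Type v) [AddCommGroup L] [Module F L] (A : SAA F L)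
      (L' : Type w) [AddCommGroup L'] [Module F L'] (A' : SAA F L') (r s : F),
      r ≠ 0 → s ≠ 0 → A.HasPresentation r → A'.HasPresentation s →
        (A.Isomorphic A' ↔ ∃ a : F, a ≠ 0 ∧ s / r = a ^ 12)) ∧
    -- conversely, every algebra with such a presentation has the stated properties
    (∀ (L : Type v) [AddCommGroup L] [Module F L] (A : SAA F L) (r : F),
      r ≠ 0 → A.HasPresentation r → A.HasProperties) ∧
    -- every such presentation does describe an algebra
    (∀ r : F, r ≠ 0 → ∃ A : SAA F (Fin 5 ⊕ Fin 5 → F), A.HasPresentation r) := by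
  refine ⟨fun L _ _ A h => ?_, fun L _ _ A L' _ _ A' r s hr hs h h' => ⟨fun hiso => ?_, ?_⟩,
    fun L _ _ A r hr h => ?_, fun r _ => ⟨SAA.model r, SAA.model_hasPresentation r⟩⟩
  · obtain ⟨x, y, hf⟩ := h.exists_adaptedFrame
    exact hf.hasPresentation h.dim_eq
  · obtain ⟨hn, x, y, hf⟩ := h.exists_frame
    obtain ⟨-, x', y', hf'⟩ := (h'.of_isomorphic hiso).exists_frame
    exact hf.div_eq_pow hf' hn hr hs
  · rintro ⟨a, ha, hsr⟩
    have hs' : s = r * a ^ 12 := by rw [← hsr, mul_div_cancel₀ _ hr]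
    exact (hs' ▸ h.scale ha : A.HasPresentation s).isomorphic h'
  · obtain ⟨hn, x, y, hf⟩ := h.exists_frame
    exact hf.hasProperties hn hr
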